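/- **Theorem 5.** Let $X=(X_n)_{n\ge 0}$ be an irreducible Markov chain on a nonempty finite or countably infinite state space $S$ with transition matrix $P$, let $K\subseteq S$ be finite and let $f:S\to\mathbb R$. Write $P_x,E_x$ (resp. $P_\mu$) for the law and expectation of the chain started in $x$ (resp. with initial distribution $\mu$), $\mathcal F_n=\sigma(X_j:j\le n)$, $\tau(z)=\inf\{n\ge 1:X_n=z\}$ and $(Pv)(x)=\sum_y P(x,y)v(y)$. Consider the following conditions. a) There is $v_1:S\to[0,\infty)$ with $(Pv_1)(x)<\infty$ for $x\in K$ and $(Pv_1)(x)\le v_1(x)-1$ for $x\notin K$. b) There is $v_2:S\to[0,\infty)$ with $(Pv_2)(x)<\infty$ for $x\in K$ and $(Pv_2)(x)\le v_2(x)-|f(x)|$ for $x\notin K$. c) There are $v_3,v_4:S\to[0,\infty)$ with $(Pv_3)(x)+(Pv_4)(x)<\infty$ for $x\in K$, and $(Pv_3)(x)\le v_3(x)-v_1(x)$ and $(Pv_4)(x)\le v_4(x)-v_2(x)$ for $x\notin K$, where $v_1$, $v_2$ are as in a) and b). Then the following hold. i) If a) holds, then $X$ is positive recurrent ($E_z\tau(z)<\infty$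 for all $z\in S$) and there is exactly one stationary distribution $\pi$. ii) If a) and b) hold, then $f\in L^1(\pi)$, that is, $\sum_x\pi(x)|f(x)|<\infty$. With $\pi f=\sum_x\pi(x)f(x)$ and $f_c=f-\pi f$, for all $x,y,z\in S$: the random variable $\sum_{j=0}^{\tau(z)-1}f_c(X_j)$ is $P_x$-integrable, so that $g_z(x)=E_x\sum_{j=0}^{\tau(z)-1}f_c(X_j)$ is finite; $\sum_{w}P(x,w)|g_z(w)|<\infty$ and $(Pg_z)(x)-g_z(x)=-f_c(x)$; $g_z(x)-g_y(x)=g_z(y)$; and $g_z(X_n)+\sum_{j=0}^{n-1}f_c(X_j)$, $n\ge 0$, is a $P_x$-martingale with respect to $(\mathcal F_n)$. iii) If a), b) and c) hold, then moreover, for all $z\in S$: $E_z\tau(z)^2<\infty$ and $E_z\sum_{j=0}^{\tau(z)-1}j|f_c(X_j)|<\infty$; $g_z\in L^1(\pi)$; $g_z(X_n)+\sum_{j=0}^{n-1}f_c(X_j)$, $n\ge 0$, is a $P_\pi$-martingale with respect to $(\mathcal F_n)$; and the random variable $\sum_{j=0}^{\tau(z)-1}(j+1)f_c(X_j)$ is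 $P_z$-integrable with $$\pi g_z=\frac{E_z\sum_{j=0}^{\tau(z)-1}(j+1)f_c(X_j)}{E_z\tau(z)}.$$ If in addition $X$ is aperiodic, then for all $x,z\in S$: $g_z(X_n)$ and $f_c(X_n)$ are $P_x$-integrable for every $n\ge 0$, $E_xg_z(X_n)\to\pi g_z$ as $n\to\infty$, and $\sum_{n=0}^\infty|E_xf_c(X_n)|<\infty$. -/

import Mathlib

open MeasureTheory ProbabilityTheory Filter
open scoped ENNReal NNReal Topology

noncomputable section

namespace MarkovChain

/-! A Markov chain on a countable discrete space `S` is given by its transition matrix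
`P : S → PMF S`, where `P x y` is the probability of a step from `x` to `y`. -/

/-- The `n`-step transition probabilities: `stepDist P n x y = Pⁿ(x, y)`. -/
def stepDist {S : Type*} (P : S → PMF S) : ℕ → S → PMF S
  | 0, x => PMF.pure x
  | n + 1, x => (P x).bind (stepDist P n)

/-- Every state can be reached from every state. -/
def Irreducible {S : Type*} (P : S → PMF S) : Prop :=
  ∀ x y, ∃ n, 0 < stepDist P n x y

/-- For every state `x`, the greatest common divisor of `{n ≥ 1 : Pⁿ(x, x) > 0}` is one. -/
def Aperiodic {S : Type*} (P : S → PMF S) : Prop :=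
  ∀ (x : S) (d : ℕ), (∀ n, 1 ≤ n → 0 < stepDist P n x x → d ∣ n) → d = 1

/-- `π P = π`, for a probability `π` on `S`. -/
def IsStationary {S : Type*} (P : S → PMF S) (π : PMF S) : Prop :=
  ∀ y, ∑' x, π x * P x y = π y

/-- `(P v)(x) = ∑_y P(x, y) v(y)` in `[0, ∞]`, for `v : S → [0, ∞)`. -/
def applyNonneg {S : Type*} (P : S → PMF S) (v : S → ℝ≥0) (x : S) : ℝ≥0∞ :=
  ∑' y, P x y * v y

/-- The Lyapunov condition: `(P v)(x) < ∞` for `x ∈ K` and `(P v)(x) ≤ v(x) - w(x)` for `x ∉ K`.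
The inequality is written as `(P v)(x) + w(x) ≤ v(x)` in `[0, ∞]`, as `v(x)` and `w(x)` are
finite. -/
structure Drift {S : Type*} (P : S → PMF S) (K : Finset S) (v w : S → ℝ≥0) : Prop where
  lt_top : ∀ x ∈ K, applyNonneg P v x < ∞
  add_le : ∀ x ∉ K, applyNonneg P v x + w x ≤ v x

/-- `h ∈ L¹(π)`. -/
def InL1 {S : Type*} (π : PMF S) (h : S → ℝ) : Prop :=
  Summable fun x => (π x).toReal * |h x|

/-- `π h = ∑_x π(x) h(x)`; it is used for `h ∈ L¹(π)`. -/
def mean {S : Type*} (π : PMF S) (h : S → ℝ) : ℝ :=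
  ∑' x, (π x).toReal * h x

/-- `f_c = f - π f`. -/
def centered {S : Type*} (π : PMF S) (f : S → ℝ) (x : S) : ℝ :=
  f x - mean π f

/-- The first return time `τ(z) = inf {n ≥ 1 : X_n = z}` on the path space `ℕ → S`, where
`X_n ω = ω n`; it is infinite if `z` is not visited after time `0`. -/
def returnTime {S : Type*} (z : S) (ω : ℕ → S) : ℕ∞ :=
  hittingAfter (fun (n : ℕ) (ω : ℕ → S) => ω n) {z} 1 ω

/-- `∑_{j=0}^{τ(z)-1} h(j, X_j)` for a nonnegative `h` (over all `j` if `τ(z) = ∞`). -/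
def cycleSumNonneg {S : Type*} (z : S) (h : ℕ → S → ℝ≥0∞) (ω : ℕ → S) : ℝ≥0∞ :=
  open Classical in ∑' j : ℕ, if (j : ℕ∞) < returnTime z ω then h j (ω j) else 0

/-- `∑_{j=0}^{τ(z)-1} h(j, X_j)` for a real-valued `h`; it is used for recurrent chains, for which
`τ(z)` is finite with probability one. -/
def cycleSum {S : Type*} (z : S) (h : ℕ → S → ℝ) (ω : ℕ → S) : ℝ :=
  ∑ j ∈ Finset.range (returnTime z ω).toNat, h j (ω j)

section Path

variable {S : Type*} [Countable S] [MeasurableSpace S] [MeasurableSingletonClass S]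

/-- The transition matrix as a Markov kernel. -/
def kernel (P : S → PMF S) : Kernel S S :=
  Kernel.ofFunOfCountable fun x => (P x).toMeasure

instance (P : S → PMF S) : IsMarkovKernel (kernel P) :=
  ⟨fun x => PMF.toMeasure.isProbabilityMeasure (P x)⟩

/-- The conditional law of `X_{n+1}` given `X_0, …, X_n`, which is `P(X_n, ·)`. -/
def historyKernel (P : S → PMF S) (n : ℕ) : Kernel (Finset.Iic n → S) S :=
  (kernel P).comap (fun h => h ⟨n, Finset.mem_Iic.2 le_rfl⟩) (measurable_pi_apply _)

instance (P : S → PMF S) (n : ℕ) : IsMarkovKernel (historyKernel P n) := by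
  unfold historyKernel
  infer_instance

/-- The law `P_μ` on the path space `ℕ → S` of the chain with initial distribution `μ`. -/
def pathLaw (P : S → PMF S) (μ : PMF S) : Measure (ℕ → S) :=
  Kernel.trajMeasure (X := fun _ => S) μ.toMeasure (historyKernel P)

/-- The law `P_x` of the chain started in `x`. -/
def pathLawFrom (P : S → PMF S) (x : S) : Measure (ℕ → S) :=
  pathLaw P (PMF.pure x)

/-- The filtration `ℱ_n = σ(X_j : j ≤ n)` on the path space. -/
def history (S : Type*) [MeasurableSpace S] :
    Filtration ℕ (MeasurableSpace.pi : MeasurableSpace (ℕ → S)) :=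
  Filtration.piLE (X := fun _ : ℕ => S)

/-- `E_z τ(z) < ∞` for every `z`. -/
def PositiveRecurrent (P : S → PMF S) : Prop :=
  ∀ z, ∫⁻ ω, (returnTime z ω : ℝ≥0∞) ∂(pathLawFrom P z) < ∞

/-- `x ↦ E_x ∑_{j=0}^{τ(z)-1} h(X_j)`; for `h = f_c` this is `g_z`. -/
def regenSol (P : S → PMF S) (h : S → ℝ) (z x : S) : ℝ :=
  ∫ ω, cycleSum z (fun _ => h) ω ∂(pathLawFrom P x)

/-- The process `g(X_n) + ∑_{j=0}^{n-1} h(X_j)`. -/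
def poissonProcess (g h : S → ℝ) (n : ℕ) (ω : ℕ → S) : ℝ :=
  g (ω n) + ∑ j ∈ Finset.range n, h (ω j)

end Path

end MarkovChain

end

/-! Fix a state z and let T u = P(1_{S∖{z}} u) be the transition operator killed on entering z. Then
(Tⁿu)(x) = E_x[u(X_n); τ(z) > n], and G = ∑ Tⁿ computes E_x ∑_{j<τ(z)} u(X_j). Most of the theorem
is algebra of P, T and G on functions with values in [0, ∞], where sums may be interchanged freely.
Real functions are split into positive and negative parts, and `lintegral_killed` translates the
results to path space.

Drift conditions act through minimality: T φ + u ≤ φ forces G u ≤ φ (`green_le_of_add_le`).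
Irreducibility makes G 1_K bounded, and v + M G 1_K is a supersolution for w, so G w ≤ v + C
(`Drift.exists_green_le`). Thus a) gives G 1 < ∞, which yields a unique π and Kac's formula π u =
π(z) (G u)(z) (`IsStationary.mul_green_eq`); b) then gives π|f| < ∞, and c) gives G G 1 < ∞ and G G
|f| < ∞. As G G = ∑ (n+1) Tⁿ, these are the weighted moments in iii), and Kac's formula for G f_c^±
yields π g_z.

From P u = T u + u(z) P 1_z follows u + P G u = G u + (G u)(z) P 1_z. The last term is the same for
u = f_c^+ and u = f_c^-, by Kac's formula and π f_c = 0, so subtraction gives Poisson's equation. A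
similar identity for two target states (`green_add_eq_green_add`) shows that g_z - g_y is constant.

In the aperiodic case two independent copies form an irreducible chain with stationary distribution
π ⊗ π. The difference E_x g(X_n) - E_y g(X_n) vanishes at x = y = c, hence is dominated by the pair
chain killed at (c, c) (`enorm_mean_sub_mean_le`); the bounds are summable in n if π|g| < ∞.
Indicators g give Pⁿ(x, ·) → π, and g = g_z with E_x f_c(X_n) = E_x g_z(X_n) - E_x g_z(X_{n+1})
gives summability. -/

noncomputable section

namespace MarkovChain

/-! ### Transition operators on nonnegative functions -/

section Operators

variable {S : Type*}

/-- The transition operator `u ↦ P u` on functions with values in `[0, ∞]`. -/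
def stepOp (P : S → PMF S) : Module.End ℝ≥0∞ (S → ℝ≥0∞) where
  toFun u x := ∑' y, P x y * u y
  map_add' u v := by
    ext x
    simp only [Pi.add_apply, mul_add, ENNReal.tsum_add]
  map_smul' c u := by
    ext x
    simp only [Pi.smul_apply, smul_eq_mul, RingHom.id_apply, ← ENNReal.tsum_mul_left]
    exact tsum_congr fun y => by ring

/-- Multiplication by the indicator of the complement of `z`. -/
def offPoint (z : S) : Module.End ℝ≥0∞ (S → ℝ≥0∞) where
  toFun u := ({z}ᶜ : Set S).indicator u
  map_add' u v := Set.indicator_add _ u v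
  map_smul' c u := Set.indicator_const_smul _ c u

/-- The transition operator of the chain killed when it enters `z`. -/
def killedOp (P : S → PMF S) (z : S) : Module.End ℝ≥0∞ (S → ℝ≥0∞) :=
  stepOp P * offPoint z

/-- The indicator function of a point. -/
def hit (z : S) : S → ℝ≥0∞ := ({z} : Set S).indicator 1

/-- The Green operator of the chain killed when it enters `z`: the expected value of
`∑_{j < τ(z)} u(X_j)`. -/
def green (P : S → PMF S) (z : S) (u : S → ℝ≥0∞) (x : S) : ℝ≥0∞ :=
  ∑' n, (killedOp P z ^ n) u x

theorem stepOp_apply (P : S → PMF S) (u : S → ℝ≥0∞) (x : S) :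
    stepOp P u x = ∑' y, P x y * u y := rfl

theorem offPoint_apply (z : S) (u : S → ℝ≥0∞) : offPoint z u = ({z}ᶜ : Set S).indicator u := rfl

theorem killedOp_apply (P : S → PMF S) (z : S) (u : S → ℝ≥0∞) :
    killedOp P z u = stepOp P (offPoint z u) := rfl

@[simp] theorem hit_self (z : S) : hit z z = 1 := by simp [hit]

theorem hit_of_ne {z x : S} (h : x ≠ z) : hit z x = 0 := by simp [hit, h]

theorem hit_le_one (z : S) : hit z ≤ 1 := by
  intro x
  by_cases h : x = z
  · simp [h]
  · simp [hit_of_ne h]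

theorem tsum_mul_hit (u : S → ℝ≥0∞) (z : S) : ∑' y, u y * hit z y = u z := by
  rw [tsum_eq_single z fun y hy => by simp [hit_of_ne hy]]
  simp

theorem tsum_mul_hit' (u : S → ℝ≥0∞) (x : S) : ∑' y, u y * hit y x = u x := by
  rw [tsum_eq_single x fun y hy => by simp [hit_of_ne hy.symm]]
  simp

theorem offPoint_le (z : S) (u : S → ℝ≥0∞) : offPoint z u ≤ u :=
  Set.indicator_le_self' fun _ _ => zero_le

theorem offPoint_add_hit (z : S) (u : S → ℝ≥0∞) : offPoint z u + u z • hit z = u := by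
  ext x
  by_cases h : x = z
  · simp [offPoint_apply, h]
  · simp [offPoint_apply, h, hit_of_ne h]

theorem offPoint_eq_self {z : S} {u : S → ℝ≥0∞} (h : u z = 0) : offPoint z u = u := by
  simpa [h] using offPoint_add_hit z u

theorem offPoint_mono (z : S) : Monotone (offPoint z) := fun _ _ h =>
  fun x => Set.indicator_le_indicator (h x)

theorem stepOp_mono (P : S → PMF S) : Monotone (stepOp P) := fun _ _ h x =>
  ENNReal.tsum_le_tsum fun y => by gcongr; exact h y

theorem killedOp_mono (P : S → PMF S) (z : S) : Monotone (killedOp P z) :=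
  (stepOp_mono P).comp (offPoint_mono z)

theorem monotone_pow {T : Module.End ℝ≥0∞ (S → ℝ≥0∞)} (hT : Monotone T) (n : ℕ) :
    Monotone (T ^ n : Module.End ℝ≥0∞ (S → ℝ≥0∞)) := by
  rw [Module.End.coe_pow]
  exact hT.iterate n

theorem stepOp_one (P : S → PMF S) : stepOp P 1 = 1 := by
  ext x
  simp [stepOp_apply, (P x).tsum_coe]

theorem stepOp_pow_one (P : S → PMF S) (n : ℕ) : (stepOp P ^ n) 1 = 1 := by
  induction n with
  | zero => rfl
  | succ n ih => rw [pow_succ, Module.End.mul_apply, stepOp_one, ih]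

theorem killedOp_le (P : S → PMF S) (z : S) (u : S → ℝ≥0∞) : killedOp P z u ≤ stepOp P u :=
  stepOp_mono P (offPoint_le z u)

theorem killedOp_pow_le (P : S → PMF S) (z : S) (n : ℕ) (u : S → ℝ≥0∞) :
    (killedOp P z ^ n) u ≤ (stepOp P ^ n) u := by
  induction n generalizing u with
  | zero => rfl
  | succ n ih =>
    rw [pow_succ, pow_succ, Module.End.mul_apply, Module.End.mul_apply]
    exact (ih _).trans (monotone_pow (stepOp_mono P) n (killedOp_le P z u))

theorem killedOp_pow_one_le (P : S → PMF S) (z : S) (n : ℕ) : (killedOp P z ^ n) 1 ≤ 1 :=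
  (killedOp_pow_le P z n 1).trans (stepOp_pow_one P n).le

/-- A step either avoids z or enters it. This decomposition is the source of Poisson's equation and
of the comparison of target states. -/
theorem stepOp_eq_killedOp_add (P : S → PMF S) (z : S) (u : S → ℝ≥0∞) :
    stepOp P u = killedOp P z u + u z • stepOp P (hit z) := by
  conv_lhs => rw [← offPoint_add_hit z u, map_add, map_smul]
  rfl

theorem stepOp_tsum (P : S → PMF S) {ι : Type*} (u : ι → S → ℝ≥0∞) :
    stepOp P (fun x => ∑' i, u i x) = fun x => ∑' i, stepOp P (u i) x := by
  ext x
  simp only [stepOp_apply, ← ENNReal.tsum_mul_left]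
  exact ENNReal.tsum_comm

theorem killedOp_tsum (P : S → PMF S) (z : S) {ι : Type*} (u : ι → S → ℝ≥0∞) :
    killedOp P z (fun x => ∑' i, u i x) = fun x => ∑' i, killedOp P z (u i) x := by
  have : offPoint z (fun x => ∑' i, u i x) = fun x => ∑' i, offPoint z (u i) x := by
    ext x
    by_cases h : x = z <;> simp [offPoint_apply, h]
  rw [killedOp_apply, this, stepOp_tsum]
  rfl

theorem killedOp_pow_tsum (P : S → PMF S) (z : S) (n : ℕ) {ι : Type*} (u : ι → S → ℝ≥0∞) :
    (killedOp P z ^ n) (fun x => ∑' i, u i x) = fun x => ∑' i, (killedOp P z ^ n) (u i) x := by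
  induction n with
  | zero => rfl
  | succ n ih =>
    simp only [pow_succ', Module.End.mul_apply]
    rw [ih, killedOp_tsum]

/-! ### The Green operator -/

theorem green_eq_add_green (P : S → PMF S) (z : S) (u : S → ℝ≥0∞) :
    green P z u = u + green P z (killedOp P z u) := by
  ext x
  rw [green, ← ENNReal.summable.sum_add_tsum_nat_add' (k := 1), Finset.sum_range_one]
  rfl

theorem green_tsum (P : S → PMF S) (z : S) {ι : Type*} (u : ι → S → ℝ≥0∞) :
    green P z (fun x => ∑' i, u i x) = fun x => ∑' i, green P z (u i) x := by
  ext x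
  simp only [green, killedOp_pow_tsum]
  exact ENNReal.tsum_comm

theorem killedOp_green (P : S → PMF S) (z : S) (u : S → ℝ≥0∞) :
    killedOp P z (green P z u) = green P z (killedOp P z u) := by
  unfold green
  rw [killedOp_tsum]
  simp only [← Module.End.mul_apply, ← pow_succ, ← pow_succ']

theorem green_eq (P : S → PMF S) (z : S) (u : S → ℝ≥0∞) :
    green P z u = u + killedOp P z (green P z u) := by
  rw [killedOp_green, ← green_eq_add_green]

theorem green_mono (P : S → PMF S) (z : S) : Monotone (green P z) := fun _ _ h x =>
  ENNReal.tsum_le_tsum fun n => monotone_pow (killedOp_mono P z) n h x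

theorem green_add (P : S → PMF S) (z : S) (u v : S → ℝ≥0∞) :
    green P z (u + v) = green P z u + green P z v := by
  ext x
  simp [green, ENNReal.tsum_add]

theorem green_smul (P : S → PMF S) (z : S) (c : ℝ≥0∞) (u : S → ℝ≥0∞) :
    green P z (c • u) = c • green P z u := by
  ext x
  simp [green, ENNReal.tsum_mul_left]

theorem green_eq_tsum_hit (P : S → PMF S) (z : S) (u : S → ℝ≥0∞) (x : S) :
    green P z u x = ∑' y, u y * green P z (hit y) x := by
  have : u = fun x => ∑' y, (u y • hit y) x := by
    ext x
    simp [tsum_mul_hit']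
  conv_lhs => rw [this, green_tsum]
  simp [green_smul]

/-- The minimality of the Green operator among supersolutions. -/
theorem green_le_of_add_le {P : S → PMF S} {z : S} {u φ : S → ℝ≥0∞}
    (h : killedOp P z φ + u ≤ φ) : green P z u ≤ φ := by
  -- The partial sums satisfy s_{n+1} = T s_n + u, so induction keeps them below φ.
  have key : ∀ n : ℕ, (∑ i ∈ Finset.range n, (killedOp P z ^ i) u) ≤ φ := by
    intro n
    induction n with
    | zero => simp
    | succ n ih =>
      rw [Finset.sum_range_succ', pow_zero, Module.End.one_apply]
      simp only [pow_succ', Module.End.mul_apply]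
      rw [← map_sum]
      exact (add_le_add_left (killedOp_mono P z ih) u).trans h
  intro x
  refine ENNReal.tsum_le_of_sum_range_le fun n => ?_
  simpa using key n x

theorem stepOp_green_le (P : S → PMF S) (z : S) (u : S → ℝ≥0∞) :
    stepOp P (green P z u) ≤ green P z u + green P z u z • 1 := by
  rw [stepOp_eq_killedOp_add P z]
  refine add_le_add ?_ ?_
  · conv_rhs => rw [green_eq]
    exact le_add_self
  · intro x
    simp only [Pi.smul_apply, smul_eq_mul]
    gcongr
    simpa [stepOp_one] using stepOp_mono P (hit_le_one z) x

/-- Each step adds at most (G u)(z), the cost of a fresh cycle from z. The bound later makes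
g_z(X_n) integrable under P_x. -/
theorem stepOp_pow_green_le (P : S → PMF S) (z : S) (u : S → ℝ≥0∞) (n : ℕ) :
    (stepOp P ^ n) (green P z u) ≤ green P z u + ((n : ℝ≥0∞) * green P z u z) • 1 := by
  induction n with
  | zero => simp
  | succ n ih =>
    rw [pow_succ', Module.End.mul_apply]
    refine (stepOp_mono P ih).trans ?_
    rw [map_add, map_smul, stepOp_one]
    refine (add_le_add_left (stepOp_green_le P z u) _).trans ?_
    rw [add_assoc, ← add_smul]
    push_cast
    rw [add_mul, one_mul, add_comm (green P z u z)]

/-- `∑_n (n + 1) Tⁿ u = G (G u)`. -/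
theorem green_green (P : S → PMF S) (z : S) (u : S → ℝ≥0∞) (x : S) :
    green P z (green P z u) x = ∑' n : ℕ, ((n : ℝ≥0∞) + 1) * (killedOp P z ^ n) u x := by
  -- Tᵐ G u is the tail of the series from index m, so Tᵏ u is counted once for each m ≤ k, that is
  -- k + 1 times.
  have h1 : ∀ m, (killedOp P z ^ m) (green P z u) x =
      ∑' k : ℕ, if m ≤ k then (killedOp P z ^ k) u x else 0 := by
    intro m
    unfold green
    rw [killedOp_pow_tsum]
    rw [← ENNReal.summable.sum_add_tsum_nat_add' (k := m)]
    rw [Finset.sum_eq_zero fun i hi => by simp [Finset.mem_range.1 hi], zero_add]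
    refine tsum_congr fun n => ?_
    rw [if_pos (by omega), add_comm n m, pow_add]
    rfl
  rw [green]
  simp only [h1]
  rw [ENNReal.tsum_comm]
  refine tsum_congr fun k => ?_
  rw [tsum_eq_sum (s := Finset.range (k + 1)) (fun m hm => by
    rw [if_neg]; simpa using hm)]
  rw [Finset.sum_congr rfl fun m hm => if_pos (by have := Finset.mem_range.1 hm; omega)]
  simp

end Operators

section Recurrence

variable {S : Type*} {P : S → PMF S}

/-! ### Irreducibility and drift conditions -/

theorem stepOp_pow_apply (P : S → PMF S) (n : ℕ) (u : S → ℝ≥0∞) (x : S) :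
    (stepOp P ^ n) u x = ∑' y, stepDist P n x y * u y := by
  induction n generalizing x with
  | zero =>
    rw [pow_zero, Module.End.one_apply, tsum_eq_single x fun y hy => by
      simp [stepDist, PMF.pure_apply, hy]]
    simp [stepDist]
  | succ n ih =>
    rw [pow_succ', Module.End.mul_apply, stepOp_apply]
    simp only [ih, stepDist, PMF.bind_apply, ← ENNReal.tsum_mul_left, ← ENNReal.tsum_mul_right]
    rw [ENNReal.tsum_comm]
    exact tsum_congr fun y => tsum_congr fun w => by ring

theorem stepOp_pow_hit (P : S → PMF S) (n : ℕ) (x z : S) :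
    (stepOp P ^ n) (hit z) x = stepDist P n x z := by
  rw [stepOp_pow_apply, tsum_mul_hit]

theorem stepDist_mul_le_stepOp_pow (P : S → PMF S) (n : ℕ) (u : S → ℝ≥0∞) (x y : S) :
    stepDist P n x y * u y ≤ (stepOp P ^ n) u x := by
  rw [stepOp_pow_apply]
  exact ENNReal.le_tsum y

theorem stepDist_mul_stepDist_le (P : S → PMF S) (m n : ℕ) (x y z : S) :
    stepDist P m x y * stepDist P n y z ≤ stepDist P (m + n) x z := by
  rw [← stepOp_pow_hit P (m + n), pow_add, Module.End.mul_apply, ← stepOp_pow_hit P n y]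
  exact stepDist_mul_le_stepOp_pow P m _ x y

theorem stepDist_one (P : S → PMF S) (x y : S) : stepDist P 1 x y = P x y := by
  rw [← stepOp_pow_hit, pow_one, stepOp_apply, tsum_mul_hit]

/-- Return times ignore time 0, whereas irreducibility alone allows n = 0 when x = z; one step is
therefore taken first. -/
theorem Irreducible.exists_succ (hP : Irreducible P) (x z : S) :
    ∃ n, 0 < stepDist P (n + 1) x z := by
  obtain ⟨y, hy⟩ := (P x).support_nonempty
  obtain ⟨n, hn⟩ := hP y z
  refine ⟨n, lt_of_lt_of_le ?_ (add_comm 1 n ▸ stepDist_mul_stepDist_le P 1 n x y z)⟩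
  rw [stepDist_one]
  exact ENNReal.mul_pos ((PMF.mem_support_iff _ _).1 hy) hn.ne'

/-- The mass sitting at z at time n + 1 has been killed, so it is missing from T^{n+1} 1. -/
theorem killedOp_pow_one_lt_one {n : ℕ} {x z : S} (h : 0 < stepDist P (n + 1) x z) :
    (killedOp P z ^ (n + 1)) 1 x < 1 := by
  have h1 : (killedOp P z ^ (n + 1)) 1 x + stepDist P (n + 1) x z ≤ 1 := by
    have h2 : (killedOp P z ^ (n + 1)) 1 x ≤ (stepOp P ^ (n + 1)) (offPoint z 1) x := by
      rw [pow_succ, pow_succ, Module.End.mul_apply, Module.End.mul_apply]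
      exact killedOp_pow_le P z n _ x
    have h3 := congrFun (congrArg (stepOp P ^ (n + 1)) (offPoint_add_hit z (1 : S → ℝ≥0∞))) x
    rw [stepOp_pow_one, Pi.one_apply, one_smul, map_add, Pi.add_apply, stepOp_pow_hit] at h3
    rw [Pi.one_apply] at h3
    exact h3 ▸ add_le_add_left h2 _
  have h4 : (killedOp P z ^ (n + 1)) 1 x ≠ ∞ :=
    ((killedOp_pow_one_le P z (n + 1) x).trans_lt ENNReal.one_lt_top).ne
  exact (ENNReal.lt_add_right h4 h.ne').trans_le h1

theorem killedOp_pow_one_antitone (P : S → PMF S) (z : S) :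
    Antitone fun n => (killedOp P z ^ n) 1 := by
  refine antitone_nat_of_succ_le fun n => ?_
  rw [pow_succ, Module.End.mul_apply]
  refine monotone_pow (killedOp_mono P z) n ?_
  simpa using killedOp_pow_one_le P z 1

/-- The expected number of visits to a finite set before hitting `z` is bounded. -/
theorem Irreducible.exists_green_indicator_le (hP : Irreducible P) (K : Finset S) (z : S) :
    ∃ C : ℝ≥0, ∀ x, green P z ((K : Set S).indicator 1) x ≤ C := by
  choose n hn using fun x => hP.exists_succ x z
  -- From each point of K the chain is killed within m steps with probability at least 1 - r > 0.
  set m := K.sup fun k => n k + 1 with hm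
  set r := K.sup fun k => (killedOp P z ^ m) 1 k with hr
  have hr1 : r < 1 := (Finset.sup_lt_iff (by simp)).2 fun k hk =>
    (killedOp_pow_one_antitone P z (Finset.le_sup (f := fun k => n k + 1) hk) k).trans_lt
      (killedOp_pow_one_lt_one (hn k))
  set u : S → ℝ≥0∞ := (K : Set S).indicator 1 with hu
  have hu1 : u ≤ 1 := Set.indicator_le_self' fun _ _ => zero_le
  let φ : ℕ → S → ℝ≥0∞ := fun N => ∑ i ∈ Finset.range N, (killedOp P z ^ i) u
  have φmono : Monotone φ := monotone_nat_of_le_succ fun N => by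
    simp only [φ, Finset.sum_range_succ]
    exact le_self_add
  have φle : ∀ N x, φ N x ≤ N := by
    intro N x
    simp only [φ, Finset.sum_apply]
    refine (Finset.sum_le_card_nsmul _ _ 1 fun i _ => ?_).trans (by simp)
    exact (monotone_pow (killedOp_mono P z) i hu1 x).trans (killedOp_pow_one_le P z i x)
  have φadd : ∀ N M, φ (N + M) = φ N + (killedOp P z ^ N) (φ M) := by
    intro N M
    simp only [φ, Finset.sum_range_add, pow_add, Module.End.mul_apply, map_sum]
  have hC : (m : ℝ≥0∞) / (1 - r) ≠ ∞ :=
    ENNReal.div_ne_top (by simp) (tsub_pos_of_lt hr1).ne'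
  have bound : ∀ N x, φ N x ≤ (m : ℝ≥0∞) / (1 - r) := by
    intro N
    set s := K.sup (φ N) with hs
    -- Maximum principle: off K, φ (j + 1) = T (φ j), so the maximum s over K is a bound everywhere.
    have hsup : ∀ j ≤ N, φ j ≤ s • 1 := by
      intro j
      induction j with
      | zero => intro _ x; simp [φ]
      | succ j ih =>
        intro hj x
        by_cases hx : x ∈ K
        · simpa using (φmono hj x).trans (Finset.le_sup (f := φ N) hx)
        · have h1 : φ (j + 1) x = u x + killedOp P z (φ j) x := by
            rw [add_comm, φadd]
            simp [φ]
          have h2 : u x = 0 := by simp [hu, hx]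
          rw [h1, h2, zero_add]
          refine (killedOp_mono P z (ih (by omega)) x).trans ?_
          rw [map_smul]
          simp only [Pi.smul_apply, smul_eq_mul]
          gcongr
          simpa using killedOp_pow_one_le P z 1 x
    -- Solving s ≤ m + r s for s requires s < ∞; this is why partial sums replace G 1_K.
    have hs_top : s ≠ ∞ := by
      refine ((Finset.sup_lt_iff (by simp)).2 fun k _ => ?_).ne
      exact (φle N k).trans_lt (ENNReal.natCast_lt_top N)
    have hsr : s ≤ m + r * s := by
      refine Finset.sup_le fun k hk => ?_
      calc φ N k ≤ φ (m + N) k := φmono (by omega) k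
        _ = φ m k + (killedOp P z ^ m) (φ N) k := by rw [φadd]; rfl
        _ ≤ m + (killedOp P z ^ m) (s • 1) k :=
          add_le_add (φle m k) (monotone_pow (killedOp_mono P z) m (hsup N le_rfl) k)
        _ ≤ m + r * s := by
          rw [map_smul, Pi.smul_apply, smul_eq_mul, mul_comm]
          gcongr
          exact Finset.le_sup (f := fun k => (killedOp P z ^ m) 1 k) hk
    have hs' : s ≤ (m : ℝ≥0∞) / (1 - r) := by
      rw [ENNReal.le_div_iff_mul_le (Or.inl (tsub_pos_of_lt hr1).ne') (Or.inl (by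
        exact (tsub_le_self.trans_lt ENNReal.one_lt_top).ne)), mul_comm,
        ENNReal.sub_mul fun _ _ => hs_top, one_mul]
      exact tsub_le_iff_right.2 hsr
    intro x
    simpa using (hsup N le_rfl x).trans (by simpa using hs')
  refine ⟨((m : ℝ≥0∞) / (1 - r)).toNNReal, fun x => ?_⟩
  rw [ENNReal.coe_toNNReal hC]
  refine ENNReal.tsum_le_of_sum_range_le fun N => ?_
  simpa [φ] using bound N x

/-- Under a drift condition, `E_x ∑_{j < τ(z)} w(X_j) ≤ v(x) + C`. -/
theorem Drift.exists_green_le (hP : Irreducible P) {K : Finset S} {v w : S → ℝ≥0}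
    (h : Drift P K v w) (z : S) :
    ∃ C : ℝ≥0, ∀ x, green P z (fun y => (w y : ℝ≥0∞)) x ≤ v x + C := by
  obtain ⟨C, hC⟩ := hP.exists_green_indicator_le K z
  set M : ℝ≥0∞ := ∑ k ∈ K, (applyNonneg P v k + w k) with hM
  have hM_top : M ≠ ∞ := ENNReal.sum_ne_top.2 fun k hk =>
    ENNReal.add_ne_top.2 ⟨(h.lt_top k hk).ne, ENNReal.coe_ne_top⟩
  set u := green P z ((K : Set S).indicator 1) with hu
  -- On K, u = 1 + T u, and the surplus M ≥ P v + w pays for the missing drift. Off K, u = T u and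
  -- the drift inequality suffices.
  have key : killedOp P z ((fun y => (v y : ℝ≥0∞)) + M • u) + (fun y => (w y : ℝ≥0∞)) ≤
      (fun y => (v y : ℝ≥0∞)) + M • u := by
    intro x
    have hux := congrFun (green_eq P z ((K : Set S).indicator 1)) x
    rw [← hu, Pi.add_apply] at hux
    have hv : killedOp P z (fun y => (v y : ℝ≥0∞)) x ≤ applyNonneg P v x := killedOp_le P z _ x
    simp only [map_add, map_smul, Pi.add_apply, Pi.smul_apply, smul_eq_mul]
    rw [hux]
    by_cases hx : x ∈ K
    · rw [Set.indicator_of_mem (by simpa using hx), Pi.one_apply, mul_add, mul_one]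
      have : applyNonneg P v x + w x ≤ M :=
        Finset.single_le_sum (f := fun k => applyNonneg P v k + w k) (fun _ _ => zero_le) hx
      calc _ = (killedOp P z (fun y => (v y : ℝ≥0∞)) x + w x) + M * killedOp P z u x := by ring
        _ ≤ M + M * killedOp P z u x := by gcongr; exact (add_le_add_left hv _).trans this
        _ ≤ _ := le_add_self
    · rw [Set.indicator_of_notMem (by simpa using hx), zero_add]
      calc _ = (killedOp P z (fun y => (v y : ℝ≥0∞)) x + w x) + M * killedOp P z u x := by ring
        _ ≤ _ := by gcongr; exact (add_le_add_left hv _).trans (h.add_le x hx)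
  refine ⟨(M * C).toNNReal, fun x => (green_le_of_add_le key x).trans ?_⟩
  rw [ENNReal.coe_toNNReal (ENNReal.mul_ne_top hM_top ENNReal.coe_ne_top)]
  simp only [Pi.add_apply, Pi.smul_apply, smul_eq_mul]
  gcongr
  exact hC x

/-- All return times have finite expectation, from every starting point. -/
def FiniteReturn (P : S → PMF S) : Prop := ∀ z x, green P z 1 x ≠ ∞

theorem Drift.green_ne_top (hP : Irreducible P) {K : Finset S} {v w : S → ℝ≥0}
    (h : Drift P K v w) (z x : S) : green P z (fun y => (w y : ℝ≥0∞)) x ≠ ∞ := by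
  obtain ⟨C, hC⟩ := h.exists_green_le hP z
  exact ne_top_of_le_ne_top (ENNReal.add_ne_top.2 ⟨ENNReal.coe_ne_top, ENNReal.coe_ne_top⟩) (hC x)

theorem Drift.finiteReturn (hP : Irreducible P) {K : Finset S} {v : S → ℝ≥0}
    (h : Drift P K v fun _ => 1) : FiniteReturn P :=
  fun z x => h.green_ne_top hP z x

/-- G is applied to G w ≤ v + C, and the second drift condition bounds G v. -/
theorem Drift.green_green_ne_top (hP : Irreducible P) (hr : FiniteReturn P) {K K' : Finset S}
    {v w v' : S → ℝ≥0} (h : Drift P K v w) (h' : Drift P K' v' v) (z x : S) :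
    green P z (green P z (fun y => (w y : ℝ≥0∞))) x ≠ ∞ := by
  obtain ⟨C, hC⟩ := h.exists_green_le hP z
  have hle : green P z (fun y => (w y : ℝ≥0∞)) ≤ (fun y => (v y : ℝ≥0∞)) + (C : ℝ≥0∞) • 1 :=
    fun x => by simpa using hC x
  refine ne_top_of_le_ne_top ?_ (green_mono P z hle x)
  rw [green_add, green_smul]
  exact ENNReal.add_ne_top.2
    ⟨h'.green_ne_top hP z x, ENNReal.mul_ne_top ENNReal.coe_ne_top (hr z x)⟩

/-- The series is ∑ P_x(τ(z) = n + 1), so this is almost sure finiteness of τ(z). It follows from G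
1 = 1 + G T 1 and 1 = T 1 + P 1_z by cancelling the finite G T 1. -/
theorem FiniteReturn.green_stepOp_hit (hr : FiniteReturn P) (z : S) :
    green P z (stepOp P (hit z)) = 1 := by
  ext x
  have h1 := congrFun (congrArg (green P z) (stepOp_eq_killedOp_add P z (1 : S → ℝ≥0∞))) x
  rw [stepOp_one, Pi.one_apply, one_smul, green_add] at h1
  have h2 := congrFun (green_eq_add_green P z 1) x
  have h3 : green P z (killedOp P z 1) x ≠ ∞ :=
    ne_top_of_le_ne_top (hr z x) (h2.symm ▸ le_add_self (a := green P z (killedOp P z 1) x))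
  rw [h1, add_comm (1 : S → ℝ≥0∞)] at h2
  exact (ENNReal.add_right_inj h3).1 h2

theorem tendsto_killedOp_pow_green {z x : S} {u : S → ℝ≥0∞} (h : green P z u x ≠ ∞) :
    Tendsto (fun n => (killedOp P z ^ n) (green P z u) x) atTop (𝓝 0) := by
  have := ENNReal.tendsto_sum_nat_add (fun n => (killedOp P z ^ n) u x) h
  refine this.congr fun n => ?_
  unfold green
  rw [killedOp_pow_tsum]
  exact tsum_congr fun k => by rw [add_comm, pow_add]; rfl

theorem tendsto_killedOp_pow {z x : S} {u : S → ℝ≥0∞} (h : green P z u x ≠ ∞) :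
    Tendsto (fun n => (killedOp P z ^ n) u x) atTop (𝓝 0) :=
  ENNReal.tendsto_atTop_zero_of_tsum_ne_top h

/-- Before hitting y the chain may pass through z several times, each excursion from z costing (G_z
u)(z), with a bounded expected number of passages. Formally, ψ + ψ(z) G_y(P 1_z) with ψ = G_z u is a
supersolution for the chain killed at y. -/
theorem exists_green_le_green_add (hP : Irreducible P) (hr : FiniteReturn P) {y z : S}
    {u : S → ℝ≥0∞} (hu : ∀ x, green P z u x ≠ ∞) :
    ∃ C : ℝ≥0, green P y u ≤ green P z u + (C : ℝ≥0∞) • 1 := by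
  obtain ⟨C, hC⟩ := hP.exists_green_indicator_le {z} y
  have hC' : green P y (stepOp P (hit z)) ≤ ((C : ℝ≥0∞) + 1) • 1 := by
    intro x
    -- The second term matters only for z = y, where T_y 1_z = 0; it accounts for the 1 in C + 1.
    have h1 : stepOp P (hit z) ≤ killedOp P y (hit z) + stepOp P (hit y) := by
      rw [stepOp_eq_killedOp_add P y]
      gcongr
      intro w
      simpa using mul_le_mul_left (hit_le_one z y) _
    refine (green_mono P y h1 x).trans ?_
    rw [green_add, hr.green_stepOp_hit]
    simp only [Pi.add_apply, Pi.one_apply, Pi.smul_apply, smul_eq_mul, mul_one]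
    gcongr
    refine le_trans ?_ (hC x)
    have : ((({z} : Finset S) : Set S).indicator 1 : S → ℝ≥0∞) = hit z := by simp [hit]
    rw [this]
    conv_rhs => rw [green_eq_add_green]
    exact le_add_self
  set ψ := green P z u with hψ
  have key : killedOp P y (ψ + ψ z • green P y (stepOp P (hit z))) + u ≤
      ψ + ψ z • green P y (stepOp P (hit z)) := by
    have h1 : killedOp P y ψ + u ≤ ψ + ψ z • stepOp P (hit z) := by
      calc killedOp P y ψ + u ≤ stepOp P ψ + u := by gcongr; exact killedOp_le P y ψ
        _ = ψ + ψ z • stepOp P (hit z) := by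
          have h2 : ψ = u + killedOp P z ψ := green_eq P z u
          rw [stepOp_eq_killedOp_add P z, add_right_comm, add_comm _ u, ← h2]
    calc _ = (killedOp P y ψ + u) + ψ z • killedOp P y (green P y (stepOp P (hit z))) := by
          rw [map_add, map_smul]; abel
      _ ≤ (ψ + ψ z • stepOp P (hit z)) + ψ z • killedOp P y (green P y (stepOp P (hit z))) := by
        gcongr
      _ = _ := by
        conv_rhs => rw [green_eq, smul_add]
        rw [add_assoc]
  refine ⟨(ψ z * (C + 1)).toNNReal, (green_le_of_add_le key).trans ?_⟩
  rw [ENNReal.coe_toNNReal (ENNReal.mul_ne_top (hu z) (by finiteness))]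
  gcongr
  intro x
  have := hC' x
  simp only [Pi.smul_apply, smul_eq_mul, Pi.one_apply, mul_one] at this ⊢
  gcongr

/-- Comparison of the Green operators for two target states. -/
theorem green_add_eq_green_add (hP : Irreducible P) (hr : FiniteReturn P) {y z : S}
    {u : S → ℝ≥0∞} (hu : ∀ x, green P z u x ≠ ∞) :
    green P y u + green P y u y • green P z (stepOp P (hit y)) =
      green P z u + green P y u z • 1 := by
  set φ := green P y u with hφ
  -- Both sides equal u + P φ, decomposed at y on the left and at z on the right. All terms stay
  -- nonnegative, as infinite values do not cancel.
  have base : φ + φ y • stepOp P (hit y) = killedOp P z φ + (u + φ z • stepOp P (hit z)) := by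
    have h1 := stepOp_eq_killedOp_add P y φ
    rw [stepOp_eq_killedOp_add P z φ] at h1
    have h2 : φ = u + killedOp P y φ := green_eq P y u
    calc φ + φ y • stepOp P (hit y) = u + killedOp P y φ + φ y • stepOp P (hit y) := by rw [← h2]
      _ = u + (killedOp P y φ + φ y • stepOp P (hit y)) := by rw [add_assoc]
      _ = _ := by rw [← h1]; abel
  have iter : ∀ N : ℕ,
      φ + ∑ n ∈ Finset.range N, (killedOp P z ^ n) (φ y • stepOp P (hit y)) =
        (killedOp P z ^ N) φ +
          ∑ n ∈ Finset.range N, (killedOp P z ^ n) (u + φ z • stepOp P (hit z)) := by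
    intro N
    induction N with
    | zero => simp
    | succ N ih =>
      have h1 := congrArg (killedOp P z ^ N) base
      rw [map_add, map_add, ← Module.End.mul_apply, ← pow_succ] at h1
      rw [Finset.sum_range_succ, Finset.sum_range_succ, ← add_assoc, ih, add_right_comm, h1]
      abel
  obtain ⟨C, hC⟩ := exists_green_le_green_add (y := y) hP hr hu
  -- φ ≤ G_z u + C, and T_z^N sends both summands to 0 pointwise, as remainders and terms of
  -- convergent series.
  have lim : ∀ x, Tendsto (fun N => (killedOp P z ^ N) φ x) atTop (𝓝 0) := by
    intro x
    have h1 := (tendsto_killedOp_pow_green (hu x)).add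
      (ENNReal.Tendsto.const_mul (a := (C : ℝ≥0∞)) (tendsto_killedOp_pow (hr z x))
        (Or.inr ENNReal.coe_ne_top))
    rw [mul_zero, add_zero] at h1
    refine tendsto_of_tendsto_of_tendsto_of_le_of_le tendsto_const_nhds h1 (fun _ => zero_le)
      fun N => ?_
    have := monotone_pow (killedOp_mono P z) N hC x
    simpa using this
  ext x
  have limsum : ∀ w : S → ℝ≥0∞, Tendsto
      (fun N => (∑ n ∈ Finset.range N, (killedOp P z ^ n) w) x) atTop (𝓝 (green P z w x)) := by
    intro w
    simp only [Finset.sum_apply]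
    exact ENNReal.tendsto_nat_tsum _
  have l1 := (tendsto_const_nhds (x := φ x)).add (limsum (φ y • stepOp P (hit y)))
  have l2 := (lim x).add (limsum (u + φ z • stepOp P (hit z)))
  have := tendsto_nhds_unique l1 (l2.congr fun N => (congrFun (iter N) x).symm)
  rw [zero_add, green_smul, green_add, green_smul, hr.green_stepOp_hit] at this
  simpa using this

end Recurrence

/-! ### Stationary distributions -/

section Stationary

variable {S : Type*} {P : S → PMF S} {π : PMF S}

theorem IsStationary.tsum_mul_stepOp (hπ : IsStationary P π) (u : S → ℝ≥0∞) :
    ∑' x, π x * stepOp P u x = ∑' x, π x * u x := by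
  simp only [stepOp_apply, ← ENNReal.tsum_mul_left]
  rw [ENNReal.tsum_comm]
  refine tsum_congr fun y => ?_
  rw [← hπ y, ← ENNReal.tsum_mul_right]
  exact tsum_congr fun x => by ring

theorem IsStationary.tsum_mul_stepOp_pow (hπ : IsStationary P π) (n : ℕ) (u : S → ℝ≥0∞) :
    ∑' x, π x * (stepOp P ^ n) u x = ∑' x, π x * u x := by
  induction n with
  | zero => rfl
  | succ n ih =>
    rw [pow_succ', Module.End.mul_apply, hπ.tsum_mul_stepOp, ih]

theorem IsStationary.mul_stepDist_le (hπ : IsStationary P π) (n : ℕ) (x y : S) :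
    π x * stepDist P n x y ≤ π y := by
  have := hπ.tsum_mul_stepOp_pow n (hit y)
  rw [tsum_mul_hit] at this
  rw [← this, ← stepOp_pow_hit]
  exact ENNReal.le_tsum x

theorem IsStationary.ne_zero (hπ : IsStationary P π) (hP : Irreducible P) (z : S) : π z ≠ 0 := by
  obtain ⟨x, hx⟩ := π.support_nonempty
  obtain ⟨n, hn⟩ := hP x z
  exact ((ENNReal.mul_pos ((PMF.mem_support_iff _ _).1 hx) hn.ne').trans_le
    (hπ.mul_stepDist_le n x z)).ne'

theorem tsum_mul_eq_add_offPoint (π : PMF S) (z : S) (u : S → ℝ≥0∞) :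
    ∑' x, π x * u x = π z * u z + ∑' x, π x * offPoint z u x := by
  conv_lhs => rw [← offPoint_add_hit z u]
  simp only [Pi.add_apply, Pi.smul_apply, smul_eq_mul, mul_add, ENNReal.tsum_add]
  rw [add_comm]
  congr 1
  rw [← tsum_mul_hit (fun x => π x * u z) z]
  exact tsum_congr fun y => by ring

/-- Split off the state z, rewrite the rest as one more killed step by stationarity, and repeat:
Kac's formula with a remainder. -/
theorem IsStationary.tsum_mul_eq (hπ : IsStationary P π) (z : S) (u : S → ℝ≥0∞) (N : ℕ) :
    ∑' x, π x * u x = π z * ∑ n ∈ Finset.range (N + 1), (killedOp P z ^ n) u z +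
      ∑' x, π x * offPoint z ((killedOp P z ^ N) u) x := by
  induction N with
  | zero => simpa using tsum_mul_eq_add_offPoint π z u
  | succ N ih =>
    rw [ih, ← hπ.tsum_mul_stepOp (offPoint z ((killedOp P z ^ N) u)), ← killedOp_apply,
      ← Module.End.mul_apply, ← pow_succ', tsum_mul_eq_add_offPoint π z,
      Finset.sum_range_succ _ (N + 1), mul_add, add_assoc]

theorem IsStationary.mul_green_le (hπ : IsStationary P π) (z : S) (u : S → ℝ≥0∞) :
    π z * green P z u z ≤ ∑' x, π x * u x := by
  rw [green, ← ENNReal.tsum_mul_left]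
  refine ENNReal.tsum_le_of_sum_range_le fun N => ?_
  rw [hπ.tsum_mul_eq z u N, ← Finset.mul_sum]
  refine le_add_right ?_
  gcongr
  exact N.le_succ

/-- A `π`-integrable function has finite expected sums over cycles. -/
theorem IsStationary.green_ne_top (hπ : IsStationary P π) (hP : Irreducible P) {u : S → ℝ≥0∞}
    (hu : ∑' x, π x * u x ≠ ∞) (z x : S) : green P z u x ≠ ∞ := by
  have hz : green P z u z ≠ ∞ := fun h => by
    have := hπ.mul_green_le z u
    rw [h, ENNReal.mul_top (hπ.ne_zero hP z)] at this
    exact hu (top_le_iff.1 this)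
  -- Finiteness passes from z to x, since Pⁿ(z, x) (G u)(x) ≤ (Pⁿ G u)(z) < ∞ with Pⁿ(z, x) > 0.
  obtain ⟨n, hn⟩ := hP z x
  intro h
  have h1 := (stepDist_mul_le_stepOp_pow P n (green P z u) z x).trans
    (stepOp_pow_green_le P z u n z)
  rw [h, ENNReal.mul_top hn.ne', top_le_iff] at h1
  simp only [Pi.add_apply, Pi.smul_apply, Pi.one_apply, smul_eq_mul, mul_one] at h1
  exact ENNReal.add_ne_top.2 ⟨hz, ENNReal.mul_ne_top (by simp) hz⟩ h1

theorem IsStationary.finiteReturn (hπ : IsStationary P π) (hP : Irreducible P) :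
    FiniteReturn P := fun z x => hπ.green_ne_top hP (by simp [π.tsum_coe]) z x

/-- Kac's formula: `π u = π(z) E_z ∑_{j < τ(z)} u(X_j)`. -/
theorem IsStationary.mul_green_eq (hπ : IsStationary P π) (hr : FiniteReturn P) (z : S)
    (u : S → ℝ≥0∞) : π z * green P z u z = ∑' x, π x * u x := by
  have lim : Tendsto (fun N => ∑' x, π x * (killedOp P z ^ N) 1 x) atTop (𝓝 0) := by
    let _ : MeasurableSpace S := ⊤
    simp only [← lintegral_count]
    rw [← lintegral_zero (μ := Measure.count (α := S))]
    refine tendsto_lintegral_of_dominated_convergence π (fun _ => measurable_from_top)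
      (fun N => .of_forall fun x => ?_) ?_ (.of_forall fun x => ?_)
    · simpa using mul_le_mul_right (killedOp_pow_one_le P z N x) (π x)
    · rw [lintegral_count]
      exact π.tsum_coe_ne_top
    · have := ENNReal.Tendsto.const_mul (a := π x) (tendsto_killedOp_pow (hr z x))
        (Or.inr (π.apply_ne_top x))
      simpa using this
  -- Point indicators come first: they are at most 1, so the remainder is at most π(T^N 1) → 0.
  -- Linearity then covers unbounded u.
  have key : ∀ y, π z * green P z (hit y) z = π y := by
    intro y
    refine le_antisymm ((hπ.mul_green_le z (hit y)).trans (tsum_mul_hit _ _).le) ?_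
    have : ∀ N, π y ≤ π z * green P z (hit y) z + ∑' x, π x * (killedOp P z ^ N) 1 x := by
      intro N
      rw [← tsum_mul_hit π y, hπ.tsum_mul_eq z (hit y) N]
      gcongr
      · exact ENNReal.sum_le_tsum _
      · exact (offPoint_le _ _ _).trans (monotone_pow (killedOp_mono P z) N (hit_le_one y) _)
    simpa using ge_of_tendsto' (lim.const_add (π z * green P z (hit y) z)) this
  rw [green_eq_tsum_hit, ← ENNReal.tsum_mul_left]
  refine tsum_congr fun y => ?_
  rw [← key y]
  ring

theorem IsStationary.mul_green_one (hπ : IsStationary P π) (hr : FiniteReturn P) (z : S) :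
    π z * green P z 1 z = 1 := by
  rw [hπ.mul_green_eq hr]
  simp [π.tsum_coe]

theorem green_one_ne_zero (P : S → PMF S) (z x : S) : green P z 1 x ≠ 0 := by
  rw [green_eq]
  simp

/-- The normalised occupation measure of a cycle from z is stationary: a shift by one step trades
the visit to z at time 0 for the one at time τ(z). Kac's formula leaves no other choice. -/
theorem FiniteReturn.existsUnique_isStationary [Nonempty S] (hr : FiniteReturn P) :
    ∃! π : PMF S, IsStationary P π := by
  obtain ⟨z⟩ := ‹Nonempty S›
  have h0 := green_one_ne_zero P z z
  have hsum : ∑' y, green P z (hit y) z / green P z 1 z = 1 := by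
    simp only [div_eq_mul_inv]
    rw [ENNReal.tsum_mul_right, ← ENNReal.mul_inv_cancel h0 (hr z z)]
    congr 1
    rw [green_eq_tsum_hit P z 1]
    simp
  refine ⟨⟨fun y => green P z (hit y) z / green P z 1 z, hsum ▸ ENNReal.summable.hasSum⟩,
    fun y => ?_, fun π hπ => ?_⟩
  · change ∑' x, green P z (hit x) z / green P z 1 z * P x y = green P z (hit y) z / green P z 1 z
    have h1 : green P z (stepOp P (hit y)) z = green P z (hit y) z := by
      rw [stepOp_eq_killedOp_add P z, green_add, green_smul, hr.green_stepOp_hit]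
      conv_rhs => rw [green_eq_add_green]
      by_cases h : z = y
      · subst h; simp [add_comm]
      · simp [hit_of_ne h]
    rw [← h1, green_eq_tsum_hit P z (stepOp P (hit y))]
    simp only [div_eq_mul_inv]
    rw [← ENNReal.tsum_mul_right]
    refine tsum_congr fun x => ?_
    rw [← pow_one (stepOp P), stepOp_pow_hit, stepDist_one]
    ring
  · ext y
    change π y = green P z (hit y) z / green P z 1 z
    have h1 := hπ.mul_green_eq hr z (hit y)
    rw [tsum_mul_hit] at h1
    rw [ENNReal.eq_div_iff h0 (hr z z), ← h1, ← mul_assoc, mul_comm (green P z 1 z),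
      hπ.mul_green_one hr, one_mul]

end Stationary

/-! ### Means of real-valued functions -/

section Mean

variable {S : Type*}

theorem inL1_iff {p : PMF S} {h : S → ℝ} : InL1 p h ↔ ∑' x, p x * ‖h x‖ₑ ≠ ∞ := by
  have : ∀ x, p x * ‖h x‖ₑ = ENNReal.ofReal ((p x).toReal * |h x|) := fun x => by
    rw [ENNReal.ofReal_mul ENNReal.toReal_nonneg, ENNReal.ofReal_toReal (p.apply_ne_top x),
      Real.enorm_eq_ofReal_abs]
  simp only [this]
  refine ⟨fun h => h.tsum_ofReal_ne_top, fun h => ?_⟩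
  refine (ENNReal.summable_toReal h).congr fun x => ?_
  rw [ENNReal.toReal_ofReal (by positivity)]

theorem InL1.summable {p : PMF S} {h : S → ℝ} (hh : InL1 p h) :
    Summable fun x => (p x).toReal * h x :=
  Summable.of_abs (hh.congr fun x => by rw [abs_mul, abs_of_nonneg ENNReal.toReal_nonneg])

theorem enorm_toReal_le {a : ℝ≥0∞} : ‖a.toReal‖ₑ ≤ a :=
  Real.enorm_of_nonneg ENNReal.toReal_nonneg ▸ ENNReal.ofReal_toReal_le

theorem inL1_sub_toReal {p : PMF S} {a b : S → ℝ≥0∞} (ha : ∑' x, p x * a x ≠ ∞)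
    (hb : ∑' x, p x * b x ≠ ∞) : InL1 p fun x => (a x).toReal - (b x).toReal := by
  rw [inL1_iff]
  refine ne_top_of_le_ne_top (ENNReal.add_ne_top.2 ⟨ha, hb⟩) ?_
  rw [← ENNReal.tsum_add]
  refine ENNReal.tsum_le_tsum fun x => ?_
  rw [← mul_add]
  gcongr
  refine enorm_sub_le.trans ?_
  gcongr <;> exact enorm_toReal_le

theorem mean_sub_toReal {p : PMF S} {a b : S → ℝ≥0∞} (ha : ∑' x, p x * a x ≠ ∞)
    (hb : ∑' x, p x * b x ≠ ∞) : mean p (fun x => (a x).toReal - (b x).toReal) =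
      (∑' x, p x * a x).toReal - (∑' x, p x * b x).toReal := by
  have key : ∀ c : S → ℝ≥0∞, ∑' x, p x * c x ≠ ∞ →
      HasSum (fun x => (p x).toReal * (c x).toReal) (∑' x, p x * c x).toReal := by
    intro c hc
    simp only [← ENNReal.toReal_mul]
    rw [ENNReal.tsum_toReal_eq (ENNReal.ne_top_of_tsum_ne_top hc)]
    exact ENNReal.hasSum_toReal hc
  unfold mean
  simp only [mul_sub]
  exact ((key a ha).sub (key b hb)).tsum_eq

theorem ofReal_sub_ofReal_neg (r : ℝ) : 
    (ENNReal.ofReal r).toReal - (ENNReal.ofReal (-r)).toReal = r := by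
  rcases le_total 0 r with h | h
  · simp [ENNReal.toReal_ofReal h, ENNReal.ofReal_of_nonpos (neg_nonpos.2 h)]
  · simp [ENNReal.toReal_ofReal (neg_nonneg.2 h), ENNReal.ofReal_of_nonpos h]

theorem ofReal_le_enorm (r : ℝ) : ENNReal.ofReal r ≤ ‖r‖ₑ := by
  rw [Real.enorm_eq_ofReal_abs]
  exact ENNReal.ofReal_le_ofReal (le_abs_self r)

theorem ofReal_neg_le_enorm (r : ℝ) : ENNReal.ofReal (-r) ≤ ‖r‖ₑ :=
  enorm_neg r ▸ ofReal_le_enorm (-r)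

theorem ofReal_add_ofReal_neg (r : ℝ) : ENNReal.ofReal r + ENNReal.ofReal (-r) = ‖r‖ₑ := by
  rw [Real.enorm_eq_ofReal_abs]
  rcases le_total 0 r with h | h
  · rw [ENNReal.ofReal_of_nonpos (by linarith : -r ≤ 0), abs_of_nonneg h, add_zero]
  · rw [ENNReal.ofReal_of_nonpos h, abs_of_nonpos h, zero_add]

theorem InL1.tsum_ofReal_ne_top {p : PMF S} {h : S → ℝ} (hh : InL1 p h) :
    ∑' x, p x * ENNReal.ofReal (h x) ≠ ∞ :=
  ne_top_of_le_ne_top (inL1_iff.1 hh)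
    (ENNReal.tsum_le_tsum fun _ => mul_le_mul_right (ofReal_le_enorm _) _)

theorem InL1.neg {p : PMF S} {h : S → ℝ} (hh : InL1 p h) : InL1 p fun x => -h x := by
  simpa [InL1] using hh

theorem InL1.mean_eq {p : PMF S} {h : S → ℝ} (hh : InL1 p h) :
    mean p h = (∑' x, p x * ENNReal.ofReal (h x)).toReal -
      (∑' x, p x * ENNReal.ofReal (-h x)).toReal := by
  rw [← mean_sub_toReal hh.tsum_ofReal_ne_top hh.neg.tsum_ofReal_ne_top]
  simp only [ofReal_sub_ofReal_neg]

theorem summable_toReal_pmf (p : PMF S) : Summable fun x => (p x).toReal :=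
  ENNReal.summable_toReal p.tsum_coe_ne_top

theorem tsum_toReal_pmf (p : PMF S) : ∑' x, (p x).toReal = 1 := by
  rw [← ENNReal.tsum_toReal_eq p.apply_ne_top, p.tsum_coe, ENNReal.toReal_one]

theorem inL1_const (p : PMF S) (c : ℝ) : InL1 p fun _ => c :=
  (summable_toReal_pmf p).mul_right _

theorem mean_const (p : PMF S) (c : ℝ) : mean p (fun _ => c) = c := by
  rw [mean, tsum_mul_right, tsum_toReal_pmf, one_mul]

theorem InL1.sub {p : PMF S} {g h : S → ℝ} (hg : InL1 p g) (hh : InL1 p h) :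
    InL1 p fun x => g x - h x := by
  refine (Summable.add hg hh).of_nonneg_of_le (fun x => by positivity) fun x => ?_
  rw [← mul_add]
  gcongr
  exact abs_sub _ _

theorem mean_sub {p : PMF S} {g h : S → ℝ} (hg : InL1 p g) (hh : InL1 p h) :
    mean p (fun x => g x - h x) = mean p g - mean p h := by
  simp only [mean, mul_sub]
  exact hg.summable.tsum_sub hh.summable

theorem enorm_mean_le {p : PMF S} {h : S → ℝ} : ‖mean p h‖ₑ ≤ ∑' x, p x * ‖h x‖ₑ := by
  by_cases hh : InL1 p h
  · rw [hh.mean_eq]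
    refine enorm_sub_le.trans ?_
    have : ∑' x, p x * ‖h x‖ₑ =
        ∑' x, p x * ENNReal.ofReal (h x) + ∑' x, p x * ENNReal.ofReal (-h x) := by
      rw [← ENNReal.tsum_add]
      exact tsum_congr fun x => by rw [← mul_add, ofReal_add_ofReal_neg]
    rw [this]
    gcongr <;> exact enorm_toReal_le
  · rw [inL1_iff, not_not] at hh
    rw [hh]
    exact le_top

theorem enorm_sub_mean_le {p : PMF S} {h : S → ℝ} (hh : InL1 p h) (c : ℝ) :
    ‖c - mean p h‖ₑ ≤ ∑' x, p x * ‖c - h x‖ₑ := by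
  rw [← mean_const p c, ← mean_sub (inL1_const p c) hh, mean_const]
  exact enorm_mean_le

theorem InL1.centered {π : PMF S} {f : S → ℝ} (hf : InL1 π f) : InL1 π (centered π f) :=
  hf.sub (inL1_const π _)

theorem InL1.mean_centered {π : PMF S} {f : S → ℝ} (hf : InL1 π f) :
    mean π (MarkovChain.centered π f) = 0 := by
  have := mean_sub hf (inL1_const π (mean π f))
  rw [mean_const, sub_self] at this
  exact this

theorem InL1.tsum_ofReal_eq {p : PMF S} {h : S → ℝ} (hh : InL1 p h) (h0 : mean p h = 0) :
    ∑' x, p x * ENNReal.ofReal (h x) = ∑' x, p x * ENNReal.ofReal (-h x) := by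
  rw [hh.mean_eq, sub_eq_zero] at h0
  exact (ENNReal.toReal_eq_toReal_iff' hh.tsum_ofReal_ne_top hh.neg.tsum_ofReal_ne_top).1 h0

end Mean

/-! ### The regenerative solution of Poisson's equation -/

section Poisson

variable {S : Type*} {P : S → PMF S} {π : PMF S}

/-- The Green operator of the chain killed at `z`, on real-valued functions. -/
def greenReal (P : S → PMF S) (z : S) (h : S → ℝ) (x : S) : ℝ :=
  (green P z (fun y => ENNReal.ofReal (h y)) x).toReal -
    (green P z (fun y => ENNReal.ofReal (-h y)) x).toReal

theorem green_ofReal_le (P : S → PMF S) (z : S) (h : S → ℝ) :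
    green P z (fun y => ENNReal.ofReal (h y)) ≤ green P z fun y => ‖h y‖ₑ :=
  green_mono P z fun _ => ofReal_le_enorm _

theorem green_ofReal_neg_le (P : S → PMF S) (z : S) (h : S → ℝ) :
    green P z (fun y => ENNReal.ofReal (-h y)) ≤ green P z fun y => ‖h y‖ₑ :=
  green_mono P z fun _ => ofReal_neg_le_enorm _

theorem enorm_greenReal_le (P : S → PMF S) (z : S) (h : S → ℝ) (x : S) :
    ‖greenReal P z h x‖ₑ ≤ green P z (fun y => ‖h y‖ₑ) x := by
  have : (fun y => ‖h y‖ₑ) = (fun y => ENNReal.ofReal (h y)) + fun y => ENNReal.ofReal (-h y) := by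
    ext y
    exact (ofReal_add_ofReal_neg _).symm
  rw [this, green_add]
  refine enorm_sub_le.trans ?_
  rw [Pi.add_apply]
  gcongr <;> exact enorm_toReal_le

theorem inL1_greenReal_of_green {p : PMF S} {z : S} {h : S → ℝ}
    (hp : ∑' x, p x * green P z (fun y => ‖h y‖ₑ) x ≠ ∞) : InL1 p (greenReal P z h) :=
  inL1_iff.2 (ne_top_of_le_ne_top hp (ENNReal.tsum_le_tsum fun x =>
    mul_le_mul_right (enorm_greenReal_le P z h x) _))

variable {h : S → ℝ}

theorem tsum_stepDist_mul_green_ne_top {z : S} {u : S → ℝ≥0∞} (hu : ∀ x, green P z u x ≠ ∞)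
    (n : ℕ) (x : S) : ∑' y, stepDist P n x y * green P z u y ≠ ∞ := by
  rw [← stepOp_pow_apply]
  refine ne_top_of_le_ne_top ?_ (stepOp_pow_green_le P z u n x)
  have := hu x
  have := hu z
  simp only [Pi.add_apply, Pi.smul_apply, Pi.one_apply, smul_eq_mul, mul_one]
  finiteness

/-- π h⁺ = π h⁻, and Kac's formula at z lets the factor π(z) ≠ 0 be cancelled. -/
theorem IsStationary.green_ofReal_self (hπ : IsStationary P π) (hr : FiniteReturn P)
    (hP : Irreducible P) (hh : InL1 π h) (h0 : mean π h = 0) (z : S) :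
    green P z (fun y => ENNReal.ofReal (h y)) z = green P z (fun y => ENNReal.ofReal (-h y)) z := by
  have := hh.tsum_ofReal_eq h0
  rw [← hπ.mul_green_eq hr z, ← hπ.mul_green_eq hr z] at this
  exact (ENNReal.mul_right_inj (hπ.ne_zero hP z) (π.apply_ne_top z)).1 this

theorem inL1_greenReal {z : S} (hu : ∀ x, green P z (fun y => ‖h y‖ₑ) x ≠ ∞) (n : ℕ) (x : S) :
    InL1 (stepDist P n x) (greenReal P z h) :=
  inL1_greenReal_of_green (tsum_stepDist_mul_green_ne_top hu n x)

theorem inL1_step_greenReal {z : S} (hu : ∀ x, green P z (fun y => ‖h y‖ₑ) x ≠ ∞) (x : S) :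
    InL1 (P x) (greenReal P z h) := by
  have := inL1_greenReal hu 1 x
  have h1 : stepDist P 1 x = P x := PMF.ext fun y => stepDist_one P x y
  rwa [h1] at this

/-- `greenReal P z h` solves Poisson's equation for `h`. -/
theorem IsStationary.mean_greenReal (hπ : IsStationary P π) (hr : FiniteReturn P)
    (hP : Irreducible P) (hh : InL1 π h) (h0 : mean π h = 0) (z : S) (x : S) :
    mean (P x) (greenReal P z h) - greenReal P z h x = -h x := by
  have hu : ∀ x, green P z (fun y => ‖h y‖ₑ) x ≠ ∞ := hπ.green_ne_top hP (inL1_iff.1 hh) z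
  set a := green P z (fun y => ENNReal.ofReal (h y)) with ha
  set b := green P z (fun y => ENNReal.ofReal (-h y)) with hb
  have ha_top : ∀ x, a x ≠ ∞ := fun x => ne_top_of_le_ne_top (hu x) (green_ofReal_le P z h x)
  have hb_top : ∀ x, b x ≠ ∞ := fun x => ne_top_of_le_ne_top (hu x) (green_ofReal_neg_le P z h x)
  have step : ∀ u : S → ℝ≥0∞, (∀ x, green P z u x ≠ ∞) → stepOp P (green P z u) x ≠ ∞ := by
    intro u hu
    have := tsum_stepDist_mul_green_ne_top hu 1 x
    rwa [← stepOp_pow_apply, pow_one] at this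
  -- The extra term comes from entering z, where G u starts afresh; by `hz` it is the same for h⁺
  -- and h⁻.
  have ida : ∀ u : S → ℝ≥0∞, u x + stepOp P (green P z u) x =
      green P z u x + green P z u z * stepOp P (hit z) x := by
    intro u
    rw [stepOp_eq_killedOp_add P z (green P z u), Pi.add_apply, ← add_assoc]
    congr 1
    conv_rhs => rw [green_eq]
    rfl
  have hz : a z = b z := hπ.green_ofReal_self hr hP hh h0 z
  have hhit : stepOp P (hit z) x ≠ ∞ :=
    ne_top_of_le_ne_top ENNReal.one_ne_top
      (by simpa [stepOp_one] using stepOp_mono P (hit_le_one z) x)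
  have e1 := congrArg ENNReal.toReal (ida fun y => ENNReal.ofReal (h y))
  have e2 := congrArg ENNReal.toReal (ida fun y => ENNReal.ofReal (-h y))
  rw [← ha, ENNReal.toReal_add ENNReal.ofReal_ne_top (step _ ha_top),
    ENNReal.toReal_add (ha_top x) (ENNReal.mul_ne_top (ha_top z) hhit)] at e1
  rw [← hb, ENNReal.toReal_add ENNReal.ofReal_ne_top (step _ hb_top),
    ENNReal.toReal_add (hb_top x) (ENNReal.mul_ne_top (hb_top z) hhit), ← hz] at e2
  have e3 : mean (P x) (greenReal P z h) = (stepOp P a x).toReal - (stepOp P b x).toReal :=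
    mean_sub_toReal (step _ ha_top) (step _ hb_top)
  have e4 := ofReal_sub_ofReal_neg (h x)
  have e5 : greenReal P z h x = (a x).toReal - (b x).toReal := rfl
  rw [e3, e5]
  linarith

theorem IsStationary.greenReal_self (hπ : IsStationary P π) (hr : FiniteReturn P)
    (hP : Irreducible P) (hh : InL1 π h) (h0 : mean π h = 0) (z : S) : greenReal P z h z = 0 := by
  rw [greenReal, hπ.green_ofReal_self hr hP hh h0, sub_self]

theorem IsStationary.greenReal_sub (hπ : IsStationary P π) (hr : FiniteReturn P)
    (hP : Irreducible P) (hh : InL1 π h) (h0 : mean π h = 0) (y z x : S) :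
    greenReal P z h x - greenReal P y h x = greenReal P z h y := by
  have hu : ∀ z x, green P z (fun y => ‖h y‖ₑ) x ≠ ∞ := hπ.green_ne_top hP (inL1_iff.1 hh)
  have ha_top : ∀ z x, green P z (fun y => ENNReal.ofReal (h y)) x ≠ ∞ := fun z x =>
    ne_top_of_le_ne_top (hu z x) (green_ofReal_le P z h x)
  have hb_top : ∀ z x, green P z (fun y => ENNReal.ofReal (-h y)) x ≠ ∞ := fun z x =>
    ne_top_of_le_ne_top (hu z x) (green_ofReal_neg_le P z h x)
  -- The term G_z(P 1_y) has the same coefficient for h⁺ and h⁻ and cancels. Evaluation at x = y,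
  -- where g_y vanishes, then identifies the constant.
  have key : ∀ x, greenReal P y h x = greenReal P z h x + greenReal P y h z := by
    intro x
    have e1 := congrArg ENNReal.toReal
      (congrFun (green_add_eq_green_add hP hr (y := y) (ha_top z)) x)
    have e2 := congrArg ENNReal.toReal
      (congrFun (green_add_eq_green_add hP hr (y := y) (hb_top z)) x)
    have hhit : green P z (stepOp P (hit y)) x ≠ ∞ := by
      refine ne_top_of_le_ne_top (hr z x) (green_mono P z ?_ x)
      rw [← stepOp_one P]
      exact stepOp_mono P (hit_le_one y)
    simp only [Pi.add_apply, Pi.smul_apply, Pi.one_apply, smul_eq_mul, mul_one] at e1 e2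
    rw [ENNReal.toReal_add (ha_top _ _) (ENNReal.mul_ne_top (ha_top _ _) hhit),
      ENNReal.toReal_add (ha_top _ _) (ha_top _ _)] at e1
    rw [ENNReal.toReal_add (hb_top _ _) (ENNReal.mul_ne_top (hb_top _ _) hhit),
      ENNReal.toReal_add (hb_top _ _) (hb_top _ _), ← hπ.green_ofReal_self hr hP hh h0 y] at e2
    simp only [greenReal]
    linarith
  have h1 := key x
  have h2 := key y
  rw [hπ.greenReal_self hr hP hh h0] at h2
  linarith

/-- The mean of `greenReal P z h` under the stationary distribution. -/
theorem IsStationary.mean_stationary_greenReal (hπ : IsStationary P π) (hr : FiniteReturn P) {z : S}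
    (hG : green P z (green P z fun y => ‖h y‖ₑ) z ≠ ∞) :
    InL1 π (greenReal P z h) ∧ mean π (greenReal P z h) =
      ((green P z (green P z fun y => ENNReal.ofReal (h y)) z).toReal -
        (green P z (green P z fun y => ENNReal.ofReal (-h y)) z).toReal) /
        (green P z 1 z).toReal := by
  -- Kac's formula gives π u = π(z) (G u)(z) ≤ π(z) (G G |h|)(z). Applied to u = G h^±, with π(z) =
  -- 1 / (G 1)(z), it also gives the mean.
  have hG' : ∀ u ≤ (green P z fun y => ‖h y‖ₑ), ∑' x, π x * u x ≠ ∞ := by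
    intro u hu
    rw [← hπ.mul_green_eq hr z u]
    exact ENNReal.mul_ne_top (π.apply_ne_top z) (ne_top_of_le_ne_top hG (green_mono P z hu z))
  refine ⟨inL1_greenReal_of_green (hG' _ le_rfl), ?_⟩
  have : mean π (greenReal P z h) = _ :=
    mean_sub_toReal (hG' _ (green_ofReal_le P z h)) (hG' _ (green_ofReal_neg_le P z h))
  have h1 := congrArg ENNReal.toReal (hπ.mul_green_one hr z)
  rw [ENNReal.toReal_mul, ENNReal.toReal_one] at h1
  rw [this, ← hπ.mul_green_eq hr z, ← hπ.mul_green_eq hr z, ENNReal.toReal_mul, ENNReal.toReal_mul,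
    ← mul_sub, eq_div_iff (right_ne_zero_of_mul_eq_one h1), mul_right_comm, h1, one_mul]

end Poisson

/-! ### Aperiodic chains: coupling with an independent copy -/

section Aperiodic

variable {S : Type*} {P : S → PMF S} {π : PMF S}

/-- The possible return times to x are closed under addition and have gcd 1, so they include all
large integers; a path from x to y is appended. -/
theorem Aperiodic.eventually_stepDist_pos (hP : Irreducible P) (ha : Aperiodic P) (x y : S) :
    ∃ N, ∀ n ≥ N, 0 < stepDist P n x y := by
  set s : Set ℕ := {n | 1 ≤ n ∧ 0 < stepDist P n x x} with hs
  have hgcd : Nat.setGcd s = 1 := ha x _ fun n h1 h2 => Nat.setGcd_dvd_of_mem ⟨h1, h2⟩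
  obtain ⟨N, hN⟩ := Nat.exists_mem_closure_of_ge s
  have hx : ∀ m ≥ N, 0 < stepDist P m x x := by
    intro m hm
    refine AddSubmonoid.closure_induction (motive := fun m _ => 0 < stepDist P m x x)
      (fun n hn => hn.2) (by simp [stepDist]) (fun a b _ _ h1 h2 => ?_)
      (hN m hm (hgcd ▸ one_dvd m))
    exact (ENNReal.mul_pos h1.ne' h2.ne').trans_le (stepDist_mul_stepDist_le P a b x x x)
  obtain ⟨k, hk⟩ := hP x y
  refine ⟨N + k, fun n hn => ?_⟩
  obtain ⟨j, rfl⟩ := Nat.exists_eq_add_of_le hn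
  rw [show N + k + j = (N + j) + k by ring]
  exact (ENNReal.mul_pos (hx (N + j) (by omega)).ne' hk.ne').trans_le
    (stepDist_mul_stepDist_le P _ _ x x y)

/-- The product of two probability mass functions. -/
def pairPMF (p q : PMF S) : PMF (S × S) := p.bind fun a => q.map (Prod.mk a)

theorem pairPMF_apply (p q : PMF S) (a b : S) : pairPMF p q (a, b) = p a * q b := by
  classical
  rw [pairPMF, PMF.bind_apply, tsum_eq_single a fun c hc => ?_]
  · rw [PMF.map_apply, tsum_eq_single b fun d hd => ?_]
    · simp
    · simp [hd.symm]
  · rw [PMF.map_apply, ENNReal.tsum_eq_zero.2 fun d => ?_, mul_zero]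
    simp [hc.symm]

theorem tsum_pairPMF_mul (p q : PMF S) (u : S × S → ℝ≥0∞) :
    ∑' r, pairPMF p q r * u r = ∑' a, p a * ∑' b, q b * u (a, b) := by
  rw [ENNReal.tsum_prod']
  refine tsum_congr fun a => ?_
  rw [← ENNReal.tsum_mul_left]
  exact tsum_congr fun b => by rw [pairPMF_apply, mul_assoc]

/-- Two independent copies of a Markov chain. -/
def pairChain (P : S → PMF S) (r : S × S) : PMF (S × S) := pairPMF (P r.1) (P r.2)

theorem stepOp_pairChain (P : S → PMF S) (u : S × S → ℝ≥0∞) (r : S × S) :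
    stepOp (pairChain P) u r = ∑' a, P r.1 a * ∑' b, P r.2 b * u (a, b) :=
  tsum_pairPMF_mul _ _ _

theorem stepDist_pairChain (P : S → PMF S) (n : ℕ) (x y a b : S) :
    stepDist (pairChain P) n (x, y) (a, b) = stepDist P n x a * stepDist P n y b := by
  induction n generalizing x y with
  | zero =>
    classical
    by_cases h1 : a = x <;> by_cases h2 : b = y <;> simp [stepDist, PMF.pure_apply, h1, h2]
  | succ n ih =>
    simp only [stepDist, PMF.bind_apply]
    refine (tsum_pairPMF_mul _ _ _).trans ?_
    simp only [ih]
    rw [← ENNReal.tsum_mul_right]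
    refine tsum_congr fun c => ?_
    rw [mul_assoc]
    congr 1
    rw [← ENNReal.tsum_mul_left]
    exact tsum_congr fun d => by ring

/-- Both coordinates must reach their targets at the same time, which aperiodicity allows at every
large time. -/
theorem Aperiodic.irreducible_pairChain (hP : Irreducible P) (ha : Aperiodic P) :
    Irreducible (pairChain P) := by
  rintro ⟨x, y⟩ ⟨a, b⟩
  obtain ⟨N, hN⟩ := ha.eventually_stepDist_pos hP x a
  obtain ⟨M, hM⟩ := ha.eventually_stepDist_pos hP y b
  refine ⟨max N M, ?_⟩
  rw [stepDist_pairChain]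
  exact ENNReal.mul_pos (hN _ (le_max_left _ _)).ne' (hM _ (le_max_right _ _)).ne'

theorem IsStationary.pairPMF (hπ : IsStationary P π) :
    IsStationary (pairChain P) (pairPMF π π) := by
  rintro ⟨a, b⟩
  rw [tsum_pairPMF_mul, pairPMF_apply]
  simp only [pairChain, pairPMF_apply]
  rw [← hπ a, ← hπ b, ← ENNReal.tsum_mul_right]
  refine tsum_congr fun c => ?_
  rw [mul_assoc]
  congr 1
  rw [← ENNReal.tsum_mul_left]
  exact tsum_congr fun d => by ring

theorem IsStationary.green_pairChain_ne_top (hπ : IsStationary P π) (hP : Irreducible P)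
    (ha : Aperiodic P) {u : S → ℝ≥0∞} (hu : ∑' x, π x * u x ≠ ∞) (z r : S × S) :
    green (pairChain P) z (fun q => u q.1 + u q.2) r ≠ ∞ := by
  refine hπ.pairPMF.green_ne_top (ha.irreducible_pairChain hP) ?_ z r
  rw [tsum_pairPMF_mul]
  simp only [mul_add, ENNReal.tsum_add, ENNReal.tsum_mul_right, π.tsum_coe, one_mul]
  exact ENNReal.add_ne_top.2 ⟨hu, hu⟩

/-! ### Iterated means -/

theorem tsum_bind_mul {α β : Type*} (p : PMF α) (k : α → PMF β) (u : β → ℝ≥0∞) :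
    ∑' b, p.bind k b * u b = ∑' a, p a * ∑' b, k a b * u b := by
  simp only [PMF.bind_apply, ← ENNReal.tsum_mul_left, ← ENNReal.tsum_mul_right]
  rw [ENNReal.tsum_comm]
  exact tsum_congr fun a => tsum_congr fun b => by ring

theorem mean_bind {p : PMF S} {k : S → PMF S} {g : S → ℝ} (hk : ∀ a, InL1 (k a) g)
    (hp : InL1 (p.bind k) g) :
    InL1 p (fun a => mean (k a) g) ∧ mean p (fun a => mean (k a) g) = mean (p.bind k) g := by
  simp only [(hk _).mean_eq]
  have h1 := hp.tsum_ofReal_ne_top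
  have h2 := hp.neg.tsum_ofReal_ne_top
  rw [hp.mean_eq]
  rw [tsum_bind_mul] at h1 h2 ⊢
  rw [tsum_bind_mul]
  exact ⟨inL1_sub_toReal h1 h2, mean_sub_toReal h1 h2⟩

theorem stepDist_succ' (P : S → PMF S) (n : ℕ) (x : S) :
    stepDist P (n + 1) x = (stepDist P n x).bind P := by
  ext y
  rw [← stepOp_pow_hit, pow_succ, Module.End.mul_apply, stepOp_pow_apply, PMF.bind_apply]
  refine tsum_congr fun w => ?_
  rw [stepOp_apply, tsum_mul_hit]

theorem IsStationary.bind_stepDist (hπ : IsStationary P π) (n : ℕ) :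
    π.bind (stepDist P n) = π := by
  ext y
  rw [PMF.bind_apply]
  simp only [← stepOp_pow_hit]
  rw [hπ.tsum_mul_stepOp_pow, tsum_mul_hit]

theorem mean_pure (x : S) (g : S → ℝ) : mean (PMF.pure x) g = g x := by
  rw [mean, tsum_eq_single x fun y hy => by simp [PMF.pure_apply, hy]]
  simp

/-- π(x) Pⁿ(x, ·) ≤ π with π(x) > 0. -/
theorem IsStationary.inL1_stepDist (hπ : IsStationary P π) (hP : Irreducible P) {g : S → ℝ}
    (hg : InL1 π g) (n : ℕ) (x : S) : InL1 (stepDist P n x) g := by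
  rw [inL1_iff] at hg ⊢
  intro h
  have h1 : π x * ∑' y, stepDist P n x y * ‖g y‖ₑ ≤ ∑' y, π y * ‖g y‖ₑ := by
    rw [← ENNReal.tsum_mul_left]
    refine ENNReal.tsum_le_tsum fun y => ?_
    rw [← mul_assoc]
    gcongr
    exact hπ.mul_stepDist_le n x y
  rw [h, ENNReal.mul_top (hπ.ne_zero hP x), top_le_iff] at h1
  exact hg h1

/-- The left side vanishes at r = (c, c), so killing the pair chain there loses nothing in the
induction. This takes the place of gluing the two copies when they meet at c. -/
theorem enorm_mean_sub_mean_le {g : S → ℝ} (hg : ∀ n x, InL1 (stepDist P n x) g) (c : S) (n : ℕ)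
    (r : S × S) : ‖mean (stepDist P n r.1) g - mean (stepDist P n r.2) g‖ₑ ≤
      (killedOp (pairChain P) (c, c) ^ n) (fun q => ‖g q.1‖ₑ + ‖g q.2‖ₑ) r := by
  induction n generalizing r with
  | zero =>
    simp only [stepDist, mean_pure, pow_zero, Module.End.one_apply]
    exact enorm_sub_le
  | succ n ih =>
    have hb : ∀ x, InL1 (P x) (fun a => mean (stepDist P n a) g) ∧
        mean (P x) (fun a => mean (stepDist P n a) g) = mean (stepDist P (n + 1) x) g := fun x =>
      mean_bind (hg n) (hg (n + 1) x)
    set D : S → ℝ := fun a => mean (stepDist P n a) g with hD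
    rw [← (hb r.1).2, ← (hb r.2).2, enorm_sub_rev, pow_succ', Module.End.mul_apply]
    refine le_trans ?_ (killedOp_mono (pairChain P) (c, c) ih r)
    rw [killedOp_apply, offPoint_eq_self (by simp), stepOp_pairChain]
    refine (enorm_sub_mean_le (hb r.1).1 _).trans ?_
    gcongr with a
    rw [enorm_sub_rev]
    exact enorm_sub_mean_le (hb r.2).1 _

theorem Aperiodic.tendsto_stepDist (hP : Irreducible P) (ha : Aperiodic P)
    (hπ : IsStationary P π) (x y : S) :
    Tendsto (fun n => (stepDist P n x y).toReal) atTop (𝓝 (π y).toReal) := by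
  set g : S → ℝ := fun w => (hit y w).toReal with hg
  have hle : ∀ w, ‖g w‖ₑ ≤ 1 := fun w => enorm_toReal_le.trans (hit_le_one y w)
  have hL1 : ∀ p : PMF S, InL1 p g := fun p => inL1_iff.2 <| ne_top_of_le_ne_top p.tsum_coe_ne_top
    (ENNReal.tsum_le_tsum fun w => (mul_le_mul_right (hle w) _).trans (mul_one _).le)
  have hmean : ∀ p : PMF S, mean p g = (p y).toReal := by
    intro p
    rw [mean, tsum_eq_single y fun w hw => by simp [hg, hit_of_ne hw]]
    simp [hg]
  have hdiff : ∀ w, Tendsto (fun n => (stepDist P n x y).toReal - (stepDist P n w y).toReal) atTop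
      (𝓝 0) := by
    intro w
    rw [tendsto_zero_iff_enorm_tendsto_zero]
    refine tendsto_of_tendsto_of_tendsto_of_le_of_le tendsto_const_nhds
      (tendsto_killedOp_pow (hπ.green_pairChain_ne_top hP ha (inL1_iff.1 (hL1 π)) (x, x) (x, w)))
      (fun _ => zero_le) fun n => ?_
    rw [← hmean, ← hmean]
    exact enorm_mean_sub_mean_le (fun n x => hL1 _) x n (x, w)
  -- Stationarity writes π(y) as the π-average of Pⁿ(w, y), so dominated convergence applies to the
  -- differences.
  have hrep : ∀ n, (stepDist P n x y).toReal - (π y).toReal =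
      ∑' w, (π w).toReal * ((stepDist P n x y).toReal - (stepDist P n w y).toReal) := by
    intro n
    have h1 := mean_bind (p := π) (k := stepDist P n) (fun a => hL1 _) (hL1 _)
    rw [hπ.bind_stepDist] at h1
    have h2 := mean_sub (inL1_const π (stepDist P n x y).toReal) h1.1
    rw [h1.2, mean_const] at h2
    simp only [hmean] at h2
    exact h2.symm
  have hlim : Tendsto (fun n => (stepDist P n x y).toReal - (π y).toReal) atTop (𝓝 0) := by
    simp only [hrep]
    rw [← tsum_zero (α := ℝ) (β := S)]
    refine tendsto_tsum_of_dominated_convergence (bound := fun w => (π w).toReal * 1)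
      ((summable_toReal_pmf π).mul_right 1) (fun w => ?_) (.of_forall fun n w => ?_)
    · simpa using (hdiff w).const_mul (π w).toReal
    · rw [norm_mul, Real.norm_of_nonneg ENNReal.toReal_nonneg]
      gcongr
      have h3 : ∀ v, (stepDist P n v y).toReal ≤ 1 := fun v =>
        ENNReal.toReal_le_of_le_ofReal zero_le_one (by simpa using PMF.coe_le_one _ _)
      rw [Real.norm_eq_abs, abs_le]
      have := h3 x
      have := h3 w
      have h4 : ∀ v, 0 ≤ (stepDist P n v y).toReal := fun v => ENNReal.toReal_nonneg
      have := h4 x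
      have := h4 w
      constructor <;> linarith
  simpa using hlim.add_const (π y).toReal

/-- Dominated convergence, with Pⁿ(x, y) ≤ π(y) / π(x) supplying the summable bound. -/
theorem Aperiodic.tendsto_mean (hP : Irreducible P) (ha : Aperiodic P)
    (hπ : IsStationary P π) {g : S → ℝ} (hg : InL1 π g) (x : S) :
    Tendsto (fun n => mean (stepDist P n x) g) atTop (𝓝 (mean π g)) := by
  have hx : 0 < (π x).toReal := ENNReal.toReal_pos (hπ.ne_zero hP x) (π.apply_ne_top x)
  refine tendsto_tsum_of_dominated_convergence
    (bound := fun y => (π x).toReal⁻¹ * ((π y).toReal * |g y|)) (Summable.mul_left _ hg)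
    (fun y => ((ha.tendsto_stepDist hP hπ x y).mul_const (g y))) (.of_forall fun n y => ?_)
  rw [norm_mul, Real.norm_of_nonneg ENNReal.toReal_nonneg, Real.norm_eq_abs, ← mul_assoc]
  gcongr
  rw [inv_mul_eq_div, le_div_iff₀ hx, mul_comm, ← ENNReal.toReal_mul]
  exact ENNReal.toReal_mono (π.apply_ne_top y) (hπ.mul_stepDist_le n x y)

/-- Means of `h` along the chain are absolutely summable, if Poisson's equation for `h` has a
`π`-integrable solution. -/
theorem Aperiodic.summable_mean (hP : Irreducible P) (ha : Aperiodic P)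
    (hπ : IsStationary P π) {g h : S → ℝ} (hg : InL1 π g)
    (hgh : ∀ x, mean (P x) g - g x = -h x) (x : S) :
    Summable fun n => |mean (stepDist P n x) h| := by
  have hgn : ∀ n x, InL1 (stepDist P n x) g := hπ.inL1_stepDist hP hg
  have hgP : ∀ x, InL1 (P x) g := fun x => by
    simpa only [show stepDist P 1 x = P x from PMF.ext fun y => stepDist_one P x y] using hgn 1 x
  set u : S × S → ℝ≥0∞ := fun q => ‖g q.1‖ₑ + ‖g q.2‖ₑ with hu
  have hG := hπ.green_pairChain_ne_top hP ha (inL1_iff.1 hg) (x, x)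
  -- In m + 1 steps the pair chain goes from (x, x) to (x, w) with probability at least P^{m+1}(x,
  -- x) Pᵐ(x, x) P(x, w), so this sum is controlled by a finite mean of G u.
  have hfin : ∑' w, P x w * green (pairChain P) (x, x) u (x, w) ≠ ∞ := by
    obtain ⟨m, hm⟩ := ha.eventually_stepDist_pos hP x x
    have h1 := tsum_stepDist_mul_green_ne_top hG (m + 1) (x, x)
    intro h2
    have h3 : stepDist P (m + 1) x x * stepDist P m x x *
        ∑' w, P x w * green (pairChain P) (x, x) u (x, w) ≤
        ∑' q, stepDist (pairChain P) (m + 1) (x, x) q * green (pairChain P) (x, x) u q := by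
      rw [← ENNReal.tsum_mul_left]
      refine le_trans (ENNReal.tsum_le_tsum fun w => ?_)
        (ENNReal.tsum_comp_le_tsum_of_injective (Prod.mk_right_injective x) _)
      rw [stepDist_pairChain, ← mul_assoc, mul_assoc (stepDist P (m + 1) x x)]
      gcongr
      rw [← stepDist_one P x w]
      exact stepDist_mul_stepDist_le P m 1 x x w
    rw [h2, ENNReal.mul_top (mul_ne_zero (hm _ (by omega)).ne' (hm _ le_rfl).ne'),
      top_le_iff] at h3
    exact h1 h3
  -- The mean of h at time n is E_x g(X_n) - E_x g(X_{n+1}). Conditioning the second term on X_1 = w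
  -- compares copies started in x and in w.
  have hbound : ∀ n, ‖mean (stepDist P n x) h‖ₑ ≤
      ∑' w, P x w * (killedOp (pairChain P) (x, x) ^ n) u (x, w) := by
    intro n
    have e1 : mean (stepDist P n x) h =
        mean (stepDist P n x) g - mean (stepDist P (n + 1) x) g := by
      have h4 := mean_bind (p := stepDist P n x) hgP (by
        rw [← stepDist_succ']
        exact hgn (n + 1) x)
      rw [← stepDist_succ'] at h4
      rw [← h4.2, ← mean_sub (hgn n x) h4.1]
      congr 1
      ext w
      linarith [hgh w]
    have h5 := mean_bind (p := P x) (hgn n) (hgn (n + 1) x)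
    rw [e1, ← show mean (P x) (fun a => mean (stepDist P n a) g) = mean (stepDist P (n + 1) x) g
      from h5.2]
    refine (enorm_sub_mean_le h5.1 _).trans ?_
    gcongr with w
    exact enorm_mean_sub_mean_le hgn x n (x, w)
  have htop : ∑' n, ‖mean (stepDist P n x) h‖ₑ ≠ ∞ := by
    refine ne_top_of_le_ne_top hfin ((ENNReal.tsum_le_tsum hbound).trans ?_)
    rw [ENNReal.tsum_comm]
    simp only [ENNReal.tsum_mul_left]
    exact le_rfl
  refine (ENNReal.summable_toReal htop).congr fun n => ?_
  rw [Real.enorm_eq_ofReal_abs, ENNReal.toReal_ofReal (abs_nonneg _)]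

end Aperiodic

/-! ### The return time -/

section ReturnTime

variable {S : Type*}

theorem lt_returnTime_iff {z : S} {ω : ℕ → S} {n : ℕ} :
    (n : ℕ∞) < returnTime z ω ↔ ∀ j, 1 ≤ j → j ≤ n → ω j ≠ z := by
  rw [← not_le]
  have : returnTime z ω ≤ (n : ℕ∞) ↔ ∃ j ∈ Set.Icc 1 n, ω j ∈ ({z} : Set S) :=
    hittingAfter_le_iff (u := fun (n : ℕ) (ω : ℕ → S) => ω n)
  rw [this]
  simp

theorem lt_returnTime_succ_iff {z : S} {ω : ℕ → S} {n : ℕ} :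
    ((n + 1 : ℕ) : ℕ∞) < returnTime z ω ↔ (n : ℕ∞) < returnTime z ω ∧ ω (n + 1) ≠ z := by
  rw [lt_returnTime_iff, lt_returnTime_iff]
  refine ⟨fun h => ⟨fun j h1 h2 => h j h1 (by omega), h _ (by omega) le_rfl⟩, fun h j h1 h2 => ?_⟩
  rcases Nat.le_succ_iff.1 h2 with h3 | rfl
  · exact h.1 j h1 h3
  · exact h.2

theorem cycleSumNonneg_of_eq_natCast {z : S} {ω : ℕ → S} {k : ℕ} (hk : returnTime z ω = k)
    (h : ℕ → S → ℝ≥0∞) : cycleSumNonneg z h ω = ∑ j ∈ Finset.range k, h j (ω j) := by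
  unfold cycleSumNonneg
  rw [tsum_eq_sum (s := Finset.range k) fun j hj => by
    rw [if_neg]
    rw [hk, Nat.cast_lt]
    simpa using hj]
  refine Finset.sum_congr rfl fun j hj => if_pos ?_
  rw [hk, Nat.cast_lt]
  exact Finset.mem_range.1 hj

end ReturnTime

/-! ### The path space -/

section PathSpace

variable {S : Type*} [Countable S] [MeasurableSpace S] [MeasurableSingletonClass S]
  {P : S → PMF S}

theorem lintegral_toMeasure (p : PMF S) (u : S → ℝ≥0∞) :
    ∫⁻ x, u x ∂p.toMeasure = ∑' x, p x * u x := by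
  rw [lintegral_countable']
  exact tsum_congr fun x => by
    rw [PMF.toMeasure_apply_singleton _ _ (measurableSet_singleton x), mul_comm]

theorem integrable_toMeasure_iff {p : PMF S} {h : S → ℝ} :
    Integrable h p.toMeasure ↔ InL1 p h := by
  rw [inL1_iff, ← lintegral_toMeasure]
  refine ⟨fun hi => hi.2.ne, fun hi => ⟨(Measurable.of_discrete).aestronglyMeasurable, ?_⟩⟩
  exact lt_top_iff_ne_top.2 hi

theorem integral_toMeasure {p : PMF S} {h : S → ℝ} (hh : InL1 p h) :
    ∫ x, h x ∂p.toMeasure = mean p h := by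
  rw [PMF.integral_eq_tsum _ _ (integrable_toMeasure_iff.2 hh)]
  rfl

instance (P : S → PMF S) (μ : PMF S) : IsProbabilityMeasure (pathLaw P μ) := by
  unfold pathLaw
  infer_instance

instance (P : S → PMF S) (x : S) : IsProbabilityMeasure (pathLawFrom P x) := by
  unfold pathLawFrom
  infer_instance

theorem lintegral_pathLaw_zero (P : S → PMF S) (μ : PMF S) (u : S → ℝ≥0∞) :
    ∫⁻ ω, u (ω 0) ∂pathLaw P μ = ∑' x, μ x * u x := by
  have hu : Measurable u := .of_discrete
  rw [pathLaw, Kernel.trajMeasure, Measure.lintegral_bind (Kernel.aemeasurable _)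
    (by fun_prop : Measurable fun ω : ℕ → S => u (ω 0)).aemeasurable]
  have : ∀ a : Finset.Iic 0 → S, ∫⁻ ω, u (ω 0) ∂Kernel.traj (X := fun _ => S) (historyKernel P) 0 a
      = u (a ⟨0, Finset.mem_Iic.2 le_rfl⟩) := by
    intro a
    rw [Kernel.lintegral_traj (X := fun _ => S) a (by fun_prop)]
    simp [Function.updateFinset]
  simp only [this]
  rw [lintegral_map (by fun_prop) (by fun_prop), ← lintegral_toMeasure]
  rfl

theorem map_frestrictLe_compProd (P : S → PMF S) (μ : PMF S) (n : ℕ) :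
    (pathLaw P μ).map (Preorder.frestrictLe (π := fun _ => S) n) ⊗ₘ historyKernel P n =
      (pathLaw P μ).map fun ω => (Preorder.frestrictLe (π := fun _ => S) n ω, ω (n + 1)) :=
  Kernel.map_frestrictLe_trajMeasure_compProd_eq_map_trajMeasure (X := fun _ => S)

theorem historyKernel_apply (P : S → PMF S) (n : ℕ) (a : Finset.Iic n → S) :
    historyKernel P n a = (P (a ⟨n, Finset.mem_Iic.2 le_rfl⟩)).toMeasure := rfl

/-- The Markov property at time `n`. -/
theorem lintegral_mul_succ (P : S → PMF S) (μ : PMF S) (n : ℕ) (F : (Finset.Iic n → S) → ℝ≥0∞)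
    (u : S → ℝ≥0∞) :
    ∫⁻ ω, F (Preorder.frestrictLe (π := fun _ => S) n ω) * u (ω (n + 1)) ∂pathLaw P μ =
      ∫⁻ ω, F (Preorder.frestrictLe (π := fun _ => S) n ω) * stepOp P u (ω n) ∂pathLaw P μ := by
  have hF : Measurable F := .of_discrete
  have hu : Measurable u := .of_discrete
  have h1 : ∫⁻ ω, F (Preorder.frestrictLe (π := fun _ => S) n ω) * u (ω (n + 1)) ∂pathLaw P μ =
      ∫⁻ q : (Finset.Iic n → S) × S, F q.1 * u q.2 ∂((pathLaw P μ).map fun ω =>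
        (Preorder.frestrictLe (π := fun _ => S) n ω, ω (n + 1))) := by
    rw [lintegral_map (by fun_prop) (by fun_prop)]
  rw [h1, ← map_frestrictLe_compProd, Measure.lintegral_compProd (by fun_prop),
    lintegral_map .of_discrete (by fun_prop)]
  refine lintegral_congr fun ω => ?_
  dsimp only
  rw [lintegral_const_mul _ hu, historyKernel_apply, lintegral_toMeasure]
  rfl

theorem lintegral_eval (P : S → PMF S) (μ : PMF S) (n : ℕ) (u : S → ℝ≥0∞) :
    ∫⁻ ω, u (ω n) ∂pathLaw P μ = ∑' x, μ x * (stepOp P ^ n) u x := by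
  induction n generalizing u with
  | zero => exact lintegral_pathLaw_zero P μ u
  | succ n ih =>
    have := lintegral_mul_succ P μ n 1 u
    simp only [Pi.one_apply, one_mul] at this
    rw [this, ih, pow_succ, Module.End.mul_apply]

theorem map_eval_pathLaw (P : S → PMF S) (μ : PMF S) (n : ℕ) :
    (pathLaw P μ).map (fun ω => ω n) = (μ.bind (stepDist P n)).toMeasure := by
  ext s hs
  rw [← lintegral_indicator_one hs, ← lintegral_indicator_one hs, lintegral_toMeasure,
    lintegral_map (measurable_one.indicator hs) (measurable_pi_apply n), lintegral_eval,
    tsum_bind_mul]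
  simp only [stepOp_pow_apply]

theorem integrable_eval {μ : PMF S} {n : ℕ} {g : S → ℝ} (hg : InL1 (μ.bind (stepDist P n)) g) :
    Integrable (fun ω : ℕ → S => g (ω n)) (pathLaw P μ) := by
  rw [← integrable_toMeasure_iff, ← map_eval_pathLaw] at hg
  exact hg.comp_measurable (measurable_pi_apply n)

theorem integrable_evalFrom {x : S} {n : ℕ} {g : S → ℝ} (hg : InL1 (stepDist P n x) g) :
    Integrable (fun ω : ℕ → S => g (ω n)) (pathLawFrom P x) :=
  integrable_eval (by rwa [PMF.pure_bind])

theorem integral_evalFrom {x : S} {n : ℕ} {g : S → ℝ} (hg : InL1 (stepDist P n x) g) :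
    ∫ ω, g (ω n) ∂pathLawFrom P x = mean (stepDist P n x) g := by
  have hm : Measurable g := .of_discrete
  rw [← integral_toMeasure hg, ← PMF.pure_bind x (stepDist P n), ← map_eval_pathLaw,
    integral_map (measurable_pi_apply n).aemeasurable hm.aestronglyMeasurable]
  rfl

/-! ### Sums over a cycle -/

open Classical in
theorem measurable_killed (z : S) (n : ℕ) (u : S → ℝ≥0∞) :
    Measurable fun ω : ℕ → S => if (n : ℕ∞) < returnTime z ω then u (ω n) else 0 := by
  have hu : Measurable u := .of_discrete
  refine Measurable.ite ?_ (by fun_prop) measurable_const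
  simp only [lt_returnTime_iff]
  have : {ω : ℕ → S | ∀ j, 1 ≤ j → j ≤ n → ω j ≠ z} =
      ⋂ j, ⋂ (_ : 1 ≤ j), ⋂ (_ : j ≤ n), (fun ω : ℕ → S => ω j) ⁻¹' {z}ᶜ := by
    ext ω
    simp
  rw [this]
  exact .iInter fun j => .iInter fun _ => .iInter fun _ =>
    measurable_pi_apply j (measurableSet_singleton z).compl

-- The bridge from operators to paths. Whether τ(z) > n is decided by X_0, …, X_n, so by the Markov
-- property one further step that avoids z replaces u by T u.
open Classical in
theorem lintegral_killed (P : S → PMF S) (μ : PMF S) (z : S) (n : ℕ) (u : S → ℝ≥0∞) :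
    ∫⁻ ω, (if (n : ℕ∞) < returnTime z ω then u (ω n) else 0) ∂pathLaw P μ =
      ∑' x, μ x * (killedOp P z ^ n) u x := by
  induction n generalizing u with
  | zero =>
    have : ∀ ω : ℕ → S, ((0 : ℕ) : ℕ∞) < returnTime z ω := fun ω =>
      lt_returnTime_iff.2 fun j h1 h2 => by omega
    simp only [this, if_true]
    exact lintegral_pathLaw_zero P μ u
  | succ n ih =>
    let F : (Finset.Iic n → S) → ℝ≥0∞ := fun a => if ∀ j (h : j ≤ n), 1 ≤ j →
      a ⟨j, Finset.mem_Iic.2 h⟩ ≠ z then 1 else 0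
    have hF : ∀ ω : ℕ → S, F (Preorder.frestrictLe (π := fun _ => S) n ω) =
        if (n : ℕ∞) < returnTime z ω then 1 else 0 := by
      intro ω
      simp only [F, lt_returnTime_iff]
      congr 1
      exact propext ⟨fun h j h1 h2 => h j h2 h1, fun h j h1 h2 => h j h2 h1⟩
    have h1 := lintegral_mul_succ P μ n F (offPoint z u)
    simp only [hF] at h1
    rw [pow_succ, Module.End.mul_apply, ← ih (killedOp P z u), killedOp_apply]
    convert h1 using 2
    · ext ω
      simp only [lt_returnTime_succ_iff]
      by_cases h2 : (n : ℕ∞) < returnTime z ω <;> by_cases h3 : ω (n + 1) = z <;>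
        simp [h2, h3, offPoint_apply]
    · ext ω
      simp

theorem lintegral_cycleSumNonneg (P : S → PMF S) (z x : S) (h : ℕ → S → ℝ≥0∞) :
    ∫⁻ ω, cycleSumNonneg z h ω ∂pathLawFrom P x = ∑' n, (killedOp P z ^ n) (h n) x := by
  unfold cycleSumNonneg
  rw [lintegral_tsum fun n => (measurable_killed z n (h n)).aemeasurable]
  refine tsum_congr fun n => ?_
  rw [pathLawFrom, lintegral_killed, tsum_eq_single x fun y hy => by simp [PMF.pure_apply, hy]]
  simp

theorem measurable_cycleSumNonneg (z : S) (h : ℕ → S → ℝ≥0∞) :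
    Measurable (cycleSumNonneg z h) := by
  unfold cycleSumNonneg
  exact Measurable.tsum fun n => measurable_killed z n (h n)

end PathSpace

/-! ### Cycle sums along a single path -/

section ReturnTime

variable {S : Type*}

theorem cycleSumNonneg_of_eq_top {z : S} {ω : ℕ → S} (hω : returnTime z ω = ⊤)
    (h : ℕ → S → ℝ≥0∞) : cycleSumNonneg z h ω = ∑' j, h j (ω j) := by
  unfold cycleSumNonneg
  refine tsum_congr fun j => if_pos ?_
  rw [hω]
  exact ENat.natCast_lt_top j

theorem cycleSumNonneg_one (z : S) (ω : ℕ → S) :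
    cycleSumNonneg z (fun _ => 1) ω = returnTime z ω := by
  rcases eq_or_ne (returnTime z ω) ⊤ with h | h
  · rw [cycleSumNonneg_of_eq_top h, h]
    simp
  · obtain ⟨k, hk⟩ := ENat.ne_top_iff_exists.1 h
    rw [cycleSumNonneg_of_eq_natCast hk.symm, ← hk]
    simp

theorem returnTime_sq_le (z : S) (ω : ℕ → S) :
    (returnTime z ω : ℝ≥0∞) ^ 2 ≤
      cycleSumNonneg z (fun j _ => 2 * ((j : ℝ≥0∞) + 1)) ω := by
  rcases eq_or_ne (returnTime z ω) ⊤ with h | h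
  · rw [cycleSumNonneg_of_eq_top h]
    refine le_top.trans_eq (Eq.symm ?_)
    rw [← top_le_iff, ← ENNReal.tsum_const_eq_top_of_ne_zero (α := ℕ) one_ne_zero]
    refine ENNReal.tsum_le_tsum fun j => ?_
    calc (1 : ℝ≥0∞) ≤ 1 * (0 + 1) := by simp
      _ ≤ 2 * ((j : ℝ≥0∞) + 1) := by gcongr <;> simp
  · obtain ⟨k, hk⟩ := ENat.ne_top_iff_exists.1 h
    rw [cycleSumNonneg_of_eq_natCast hk.symm, ← hk]
    -- The sum equals k(k + 1).
    have key : ∀ k : ℕ, k ^ 2 ≤ ∑ j ∈ Finset.range k, 2 * (j + 1) := by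
      intro k
      induction k with
      | zero => simp
      | succ k ih =>
        rw [Finset.sum_range_succ]
        nlinarith
    rw [ENat.toENNReal_coe]
    exact_mod_cast key k

theorem cycleSum_eq_sub {z : S} {ω : ℕ → S} (hω : returnTime z ω ≠ ⊤) (h : ℕ → S → ℝ) :
    cycleSum z h ω = (cycleSumNonneg z (fun j y => ENNReal.ofReal (h j y)) ω).toReal -
      (cycleSumNonneg z (fun j y => ENNReal.ofReal (-h j y)) ω).toReal := by
  obtain ⟨k, hk⟩ := ENat.ne_top_iff_exists.1 hω
  rw [cycleSumNonneg_of_eq_natCast hk.symm, cycleSumNonneg_of_eq_natCast hk.symm, cycleSum, ← hk,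
    ENat.toNat_natCast, ENNReal.toReal_sum fun _ _ => ENNReal.ofReal_ne_top,
    ENNReal.toReal_sum fun _ _ => ENNReal.ofReal_ne_top, ← Finset.sum_sub_distrib]
  exact Finset.sum_congr rfl fun j _ => (ofReal_sub_ofReal_neg _).symm

end ReturnTime

/-! ### Expected cycle sums and martingales -/

section PathSpace

variable {S : Type*} [Countable S] [MeasurableSpace S] [MeasurableSingletonClass S]
  {P : S → PMF S}

theorem lintegral_returnTime (P : S → PMF S) (z x : S) :
    ∫⁻ ω, (returnTime z ω : ℝ≥0∞) ∂pathLawFrom P x = green P z 1 x := by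
  simp only [← cycleSumNonneg_one]
  rw [lintegral_cycleSumNonneg]
  rfl

theorem FiniteReturn.positiveRecurrent (hr : FiniteReturn P) : PositiveRecurrent P := fun z => by
  rw [lintegral_returnTime]
  exact lt_top_iff_ne_top.2 (hr z z)

theorem FiniteReturn.ae_returnTime_ne_top (hr : FiniteReturn P) (z x : S) :
    ∀ᵐ ω ∂pathLawFrom P x, returnTime z ω ≠ ⊤ := by
  have h1 := lintegral_returnTime P z x
  simp only [← cycleSumNonneg_one] at h1
  filter_upwards [ae_lt_top (measurable_cycleSumNonneg z _) (h1.trans_ne (hr z x))] with ω hω h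
  rw [cycleSumNonneg_one, h] at hω
  exact hω.ne rfl

theorem FiniteReturn.integrable_cycleSum (hr : FiniteReturn P) {z x : S} {h : ℕ → S → ℝ}
    (hfin : ∑' n, (killedOp P z ^ n) (fun y => ‖h n y‖ₑ) x ≠ ∞) :
    Integrable (cycleSum z h) (pathLawFrom P x) ∧ ∫ ω, cycleSum z h ω ∂pathLawFrom P x =
      (∑' n, (killedOp P z ^ n) (fun y => ENNReal.ofReal (h n y)) x).toReal -
        (∑' n, (killedOp P z ^ n) (fun y => ENNReal.ofReal (-h n y)) x).toReal := by
  have h1 : ∫⁻ ω, cycleSumNonneg z (fun j y => ENNReal.ofReal (h j y)) ω ∂pathLawFrom P x ≠ ∞ := by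
    rw [lintegral_cycleSumNonneg]
    exact ne_top_of_le_ne_top hfin (ENNReal.tsum_le_tsum fun n =>
      monotone_pow (killedOp_mono P z) n (fun _ => ofReal_le_enorm _) x)
  have h2 : ∫⁻ ω, cycleSumNonneg z (fun j y => ENNReal.ofReal (-h j y)) ω ∂pathLawFrom P x ≠ ∞ := by
    rw [lintegral_cycleSumNonneg]
    exact ne_top_of_le_ne_top hfin (ENNReal.tsum_le_tsum fun n =>
      monotone_pow (killedOp_mono P z) n (fun _ => ofReal_neg_le_enorm _) x)
  have i1 := integrable_toReal_of_lintegral_ne_top (measurable_cycleSumNonneg z _).aemeasurable h1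
  have i2 := integrable_toReal_of_lintegral_ne_top (measurable_cycleSumNonneg z _).aemeasurable h2
  -- For τ(z) = ∞ the real cycle sum is 0 by default (`toNat` of `⊤`); that event is null.
  have hae : cycleSum z h =ᵐ[pathLawFrom P x] fun ω =>
      (cycleSumNonneg z (fun j y => ENNReal.ofReal (h j y)) ω).toReal -
        (cycleSumNonneg z (fun j y => ENNReal.ofReal (-h j y)) ω).toReal := by
    filter_upwards [hr.ae_returnTime_ne_top z x] with ω hω
    exact cycleSum_eq_sub hω h
  refine ⟨(i1.sub i2).congr hae.symm, ?_⟩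
  rw [integral_congr_ae hae, integral_sub i1 i2,
    integral_toReal (measurable_cycleSumNonneg z _).aemeasurable
      (ae_lt_top (measurable_cycleSumNonneg z _) h1),
    integral_toReal (measurable_cycleSumNonneg z _).aemeasurable
      (ae_lt_top (measurable_cycleSumNonneg z _) h2),
    lintegral_cycleSumNonneg, lintegral_cycleSumNonneg]

theorem FiniteReturn.regenSol_eq (hr : FiniteReturn P) {h : S → ℝ} {z : S}
    (hfin : ∀ x, green P z (fun y => ‖h y‖ₑ) x ≠ ∞) : regenSol P h z = greenReal P z h :=
  funext fun x => (hr.integrable_cycleSum (h := fun _ => h) (hfin x)).2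

/-! ### Martingales -/

/-- An event in ℱ_n is a preimage under restriction to times ≤ n, and the joint law of this
restriction and X_{n+1} disintegrates through `historyKernel`. -/
theorem setIntegral_succ {μ : PMF S} {n : ℕ} {g : S → ℝ}
    (hg : Integrable (fun ω : ℕ → S => g (ω (n + 1))) (pathLaw P μ)) (hgP : ∀ x, InL1 (P x) g)
    {s : Set (ℕ → S)} (hs : MeasurableSet[history S n] s) :
    ∫ ω in s, g (ω (n + 1)) ∂pathLaw P μ = ∫ ω in s, mean (P (ω n)) g ∂pathLaw P μ := by
  have hm : Measurable g := .of_discrete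
  rw [history, Filtration.piLE_eq_comap_frestrictLe] at hs
  obtain ⟨t, ht, rfl⟩ := hs
  have hpair : Measurable fun ω : ℕ → S =>
    (Preorder.frestrictLe (π := fun _ => S) n ω, ω (n + 1)) := by fun_prop
  have hrestr : Measurable (Preorder.frestrictLe (π := fun _ : ℕ => S) n) := by fun_prop
  have hi : Integrable (fun q : (Finset.Iic n → S) × S => g q.2) ((pathLaw P μ).map
      fun ω => (Preorder.frestrictLe (π := fun _ => S) n ω, ω (n + 1))) :=
    (integrable_map_measure (by fun_prop) hpair.aemeasurable).2 hg
  have h1 : ∫ ω in Preorder.frestrictLe (π := fun _ => S) n ⁻¹' t, g (ω (n + 1)) ∂pathLaw P μ =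
      ∫ q in t ×ˢ Set.univ, g q.2 ∂((pathLaw P μ).map
        fun ω => (Preorder.frestrictLe (π := fun _ => S) n ω, ω (n + 1))) := by
    rw [setIntegral_map (ht.prod .univ) (by fun_prop) hpair.aemeasurable]
    congr 2
    ext ω
    simp
  rw [h1, ← map_frestrictLe_compProd]
  rw [← map_frestrictLe_compProd] at hi
  rw [Measure.setIntegral_compProd ht .univ hi.integrableOn,
    setIntegral_map ht (Measurable.of_discrete).aestronglyMeasurable hrestr.aemeasurable]
  refine integral_congr_ae (.of_forall fun ω => ?_)
  simp only [Measure.restrict_univ]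
  rw [historyKernel_apply, integral_toMeasure (hgP _)]
  rfl

theorem stronglyAdapted_eval {n m : ℕ} (hn : n ≤ m) (h : S → ℝ) :
    StronglyMeasurable[history S m] fun ω : ℕ → S => h (ω n) := by
  have hm : Measurable h := .of_discrete
  have h1 : Measurable[history S m] fun ω : ℕ → S => ω n := by
    rw [history, Filtration.piLE_eq_comap_frestrictLe]
    exact (measurable_pi_apply (⟨n, Finset.mem_Iic.2 hn⟩ : Finset.Iic m)).comp
      (comap_measurable (Preorder.frestrictLe (π := fun _ : ℕ => S) m))
  exact (hm.comp h1).stronglyMeasurable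

/-- A solution of Poisson's equation yields a martingale. -/
theorem martingale_poissonProcess {μ : PMF S} {g h : S → ℝ}
    (hg : ∀ n, InL1 (μ.bind (stepDist P n)) g) (hh : ∀ n, InL1 (μ.bind (stepDist P n)) h)
    (hgP : ∀ x, InL1 (P x) g) (heq : ∀ x, mean (P x) g - g x = -h x) :
    Martingale (poissonProcess g h) (history S) (pathLaw P μ) := by
  have ig := fun n => integrable_eval (hg n)
  have ih := fun n => integrable_eval (hh n)
  have isum : ∀ n, Integrable (fun ω : ℕ → S => ∑ j ∈ Finset.range n, h (ω j)) (pathLaw P μ) :=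
    fun n => integrable_finsetSum _ fun j _ => ih j
  refine martingale_of_setIntegral_eq_succ (fun n => ?_) (fun n => (ig n).add (isum n))
    fun n s hs => ?_
  · refine (stronglyAdapted_eval le_rfl g).add ?_
    exact Finset.stronglyMeasurable_fun_sum _ fun j hj =>
      stronglyAdapted_eval (Finset.mem_range.1 hj).le h
  · simp only [poissonProcess]
    rw [integral_add (ig n).integrableOn (isum n).integrableOn,
      integral_add (ig (n + 1)).integrableOn (isum (n + 1)).integrableOn,
      setIntegral_succ (ig (n + 1)) hgP hs]
    simp only [Finset.sum_range_succ]
    rw [integral_add (isum n).integrableOn (ih n).integrableOn]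
    have h1 : ∀ x, mean (P x) g = g x - h x := fun x => by linarith [heq x]
    simp only [h1]
    rw [integral_sub (ig n).integrableOn (ih n).integrableOn]
    ring

end PathSpace

/-! ### Second-order moments of a cycle -/

section Moments

variable {S : Type*} {P : S → PMF S}

theorem tsum_killedOp_pow_natCast_add_one (P : S → PMF S) (z x : S) (u : S → ℝ≥0∞) :
    ∑' n : ℕ, (killedOp P z ^ n) (fun y => ((n : ℝ≥0∞) + 1) * u y) x =
      green P z (green P z u) x := by
  rw [green_green]
  refine tsum_congr fun n => ?_
  have : (fun y => ((n : ℝ≥0∞) + 1) * u y) = ((n : ℝ≥0∞) + 1) • u := rfl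
  rw [this, map_smul]
  rfl

theorem enorm_centered_le (π : PMF S) (f : S → ℝ) :
    (fun y => ‖centered π f y‖ₑ) ≤ (fun y => ‖f y‖ₑ) + ‖mean π f‖ₑ • 1 := fun y => by
  simp only [Pi.add_apply, Pi.smul_apply, Pi.one_apply, smul_eq_mul, mul_one]
  exact enorm_sub_le

theorem green_green_centered_ne_top (π : PMF S) {f : S → ℝ} {z x : S}
    (h1 : green P z (green P z 1) x ≠ ∞) (hf : green P z (green P z fun y => ‖f y‖ₑ) x ≠ ∞) :
    green P z (green P z fun y => ‖centered π f y‖ₑ) x ≠ ∞ := by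
  refine ne_top_of_le_ne_top ?_ (green_mono P z (green_mono P z (enorm_centered_le π f)) x)
  rw [green_add, green_smul, green_add, green_smul]
  exact ENNReal.add_ne_top.2 ⟨hf, ENNReal.mul_ne_top enorm_ne_top h1⟩

variable [Countable S] [MeasurableSpace S] [MeasurableSingletonClass S]

theorem lintegral_returnTime_sq_le (P : S → PMF S) (z x : S) :
    ∫⁻ ω, (returnTime z ω : ℝ≥0∞) ^ 2 ∂pathLawFrom P x ≤ 2 * green P z (green P z 1) x := by
  refine (lintegral_mono (returnTime_sq_le z)).trans ?_
  rw [lintegral_cycleSumNonneg, ← smul_eq_mul, ← Pi.smul_apply, ← green_smul, ← green_smul,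
    ← tsum_killedOp_pow_natCast_add_one]
  refine (tsum_congr fun n => ?_).le
  refine congrFun (congrArg _ (funext fun y => ?_)) x
  simp [mul_comm]

theorem lintegral_cycleSumNonneg_mul_le (P : S → PMF S) (z x : S) (u : S → ℝ≥0∞) :
    ∫⁻ ω, cycleSumNonneg z (fun j y => (j : ℝ≥0∞) * u y) ω ∂pathLawFrom P x ≤
      green P z (green P z u) x := by
  rw [lintegral_cycleSumNonneg, ← tsum_killedOp_pow_natCast_add_one]
  refine ENNReal.tsum_le_tsum fun n => monotone_pow (killedOp_mono P z) n (fun y => ?_) x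
  dsimp only
  gcongr
  exact le_self_add

theorem FiniteReturn.integrable_cycleSum_natCast_add_one (hr : FiniteReturn P) {z x : S}
    {h : S → ℝ} (hG : green P z (green P z fun y => ‖h y‖ₑ) x ≠ ∞) :
    Integrable (cycleSum z fun j y => ((j : ℝ) + 1) * h y) (pathLawFrom P x) ∧
      ∫ ω, cycleSum z (fun j y => ((j : ℝ) + 1) * h y) ω ∂pathLawFrom P x =
        (green P z (green P z fun y => ENNReal.ofReal (h y)) x).toReal -
          (green P z (green P z fun y => ENNReal.ofReal (-h y)) x).toReal := by
  have hn : ∀ n : ℕ, ENNReal.ofReal ((n : ℝ) + 1) = (n : ℝ≥0∞) + 1 := fun n => by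
    rw [ENNReal.ofReal_add (by positivity) zero_le_one, ENNReal.ofReal_natCast, ENNReal.ofReal_one]
  have e1 : ∀ (n : ℕ) y, ‖((n : ℝ) + 1) * h y‖ₑ = ((n : ℝ≥0∞) + 1) * ‖h y‖ₑ := fun n y => by
    rw [enorm_mul, Real.enorm_of_nonneg (by positivity), hn]
  have e2 : ∀ (n : ℕ) (r : ℝ), ENNReal.ofReal (((n : ℝ) + 1) * r) =
      ((n : ℝ≥0∞) + 1) * ENNReal.ofReal r := fun n r => by
    rw [ENNReal.ofReal_mul (by positivity), hn]
  have := hr.integrable_cycleSum (z := z) (x := x) (h := fun j y => ((j : ℝ) + 1) * h y) (by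
    simp only [e1]
    rwa [tsum_killedOp_pow_natCast_add_one])
  simp only [← mul_neg, e2] at this
  rwa [tsum_killedOp_pow_natCast_add_one, tsum_killedOp_pow_natCast_add_one] at this

end Moments

end MarkovChain

end

/-! ### The main theorem -/

open MarkovChain in
theorem theorem5 {S : Type*} [Countable S] [Nonempty S] [MeasurableSpace S]
    [MeasurableSingletonClass S] (P : S → PMF S) (hP : MarkovChain.Irreducible P) (K : Finset S)
    (v₁ : S → ℝ≥0) (ha : Drift P K v₁ (fun _ => 1)) :
    -- i)
    PositiveRecurrent P ∧ (∃! π : PMF S, IsStationary P π) ∧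
    ∀ (f : S → ℝ) (v₂ : S → ℝ≥0), Drift P K v₂ (fun x => ‖f x‖₊) →
      ∀ π : PMF S, IsStationary P π →
        -- ii) the hypothesis of the first two theorems
        InL1 π f ∧
        -- `g_z` is finite-valued
        (∀ z x, Integrable (cycleSum z (fun _ => centered π f)) (pathLawFrom P x)) ∧
        -- `g_z` solves Poisson's equation for `f_c`
        (∀ z x, Summable (fun y => (P x y).toReal * |regenSol P (centered π f) z y|) ∧
          ∑' y, (P x y).toReal * regenSol P (centered π f) z y - regenSol P (centered π f) z x =
            -centered π f x) ∧
        -- `g_z - g_y` is the constant `g_z(y)`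
        (∀ y z x, regenSol P (centered π f) z x - regenSol P (centered π f) y x =
          regenSol P (centered π f) z y) ∧
        -- martingale property under `P_x`
        (∀ x z, Martingale (poissonProcess (regenSol P (centered π f) z) (centered π f))
          (history S) (pathLawFrom P x)) ∧
        -- iii)
        ∀ v₃ v₄ : S → ℝ≥0, Drift P K v₃ v₁ → Drift P K v₄ v₂ →
          -- the hypotheses of the third and the fourth theorem
          (∀ z, ∫⁻ ω, (returnTime z ω : ℝ≥0∞) ^ 2 ∂(pathLawFrom P z) < ∞ ∧
            ∫⁻ ω, cycleSumNonneg z (fun j y => (j : ℝ≥0∞) * ‖centered π f y‖ₑ) ω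
              ∂(pathLawFrom P z) < ∞) ∧
          -- `g_y ∈ L¹(π)` and the martingale property under `P_π`
          (∀ y, InL1 π (regenSol P (centered π f) y)) ∧
          (∀ z, Martingale (poissonProcess (regenSol P (centered π f) z) (centered π f))
            (history S) (pathLaw P π)) ∧
          -- the formula for `π g_z`
          (∀ z, Integrable (cycleSum z (fun j y => ((j : ℝ) + 1) * centered π f y))
              (pathLawFrom P z) ∧
            mean π (regenSol P (centered π f) z) =
              (∫ ω, cycleSum z (fun j y => ((j : ℝ) + 1) * centered π f y) ω ∂(pathLawFrom P z)) /
                (∫⁻ ω, (returnTime z ω : ℝ≥0∞) ∂(pathLawFrom P z)).toReal) ∧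
          (MarkovChain.Aperiodic P →
            -- `E_x g_z(X_n) → π g_z`
            (∀ z x, (∀ n, Integrable (fun ω => regenSol P (centered π f) z (ω n))
                (pathLawFrom P x)) ∧
              Tendsto (fun n : ℕ => ∫ ω, regenSol P (centered π f) z (ω n) ∂(pathLawFrom P x))
                atTop (𝓝 (mean π (regenSol P (centered π f) z)))) ∧
            -- `∑_n |E_x f_c(X_n)| < ∞`
            (∀ x, (∀ n, Integrable (fun ω => centered π f (ω n)) (pathLawFrom P x)) ∧
              Summable (fun n : ℕ => |∫ ω, centered π f (ω n) ∂(pathLawFrom P x)|))) := by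
  have hr : FiniteReturn P := ha.finiteReturn hP
  refine ⟨hr.positiveRecurrent, hr.existsUnique_isStationary, fun f v₂ hb π hπ => ?_⟩
  -- By Kac's formula π|f| = π(z) (G |f|)(z) at any one state z, and b) makes this finite.
  have hf : InL1 π f := by
    obtain ⟨z⟩ := ‹Nonempty S›
    rw [inL1_iff, ← hπ.mul_green_eq hr z]
    exact ENNReal.mul_ne_top (π.apply_ne_top z) (hb.green_ne_top hP z z)
  set h := centered π f with hh
  have hL : InL1 π h := hf.centered
  have h0 : mean π h = 0 := hf.mean_centered
  have hfin : ∀ z x, green P z (fun y => ‖h y‖ₑ) x ≠ ∞ := hπ.green_ne_top hP (inL1_iff.1 hL)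
  have hreg : ∀ z, regenSol P h z = greenReal P z h := fun z => hr.regenSol_eq (hfin z)
  simp only [hreg]
  have heq := hπ.mean_greenReal hr hP hL h0
  have hstep := fun z x => inL1_step_greenReal (hfin z) x
  refine ⟨hf, fun z x => (hr.integrable_cycleSum (h := fun _ => h) (hfin z x)).1,
    fun z x => ⟨hstep z x, heq z x⟩, hπ.greenReal_sub hr hP hL h0, fun x z => ?_, ?_⟩
  · refine martingale_poissonProcess (fun n => ?_) (fun n => ?_) (hstep z) (heq z)
    · rw [PMF.pure_bind]
      exact inL1_greenReal (hfin z) n x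
    · rw [PMF.pure_bind]
      exact hπ.inL1_stepDist hP hL n x
  intro v₃ v₄ hc₃ hc₄
  have hG1 : ∀ z, green P z (green P z 1) z ≠ ∞ := fun z => ha.green_green_ne_top hP hr hc₃ z z
  have hG : ∀ z, green P z (green P z fun y => ‖h y‖ₑ) z ≠ ∞ := fun z =>
    green_green_centered_ne_top π (hG1 z) (hb.green_green_ne_top hP hr hc₄ z z)
  have hgL : ∀ z, InL1 π (greenReal P z h) := fun z =>
    (hπ.mean_stationary_greenReal hr (hG z)).1
  refine ⟨fun z => ⟨?_, ?_⟩, hgL, fun z => ?_, fun z => ?_, fun hap => ⟨fun z x => ?_, fun x => ?_⟩⟩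
  · exact (lintegral_returnTime_sq_le P z z).trans_lt
      (ENNReal.mul_lt_top ENNReal.ofNat_lt_top (lt_top_iff_ne_top.2 (hG1 z)))
  · exact (lintegral_cycleSumNonneg_mul_le P z z _).trans_lt (lt_top_iff_ne_top.2 (hG z))
  · refine martingale_poissonProcess (fun n => ?_) (fun n => ?_) (hstep z) (heq z)
    · rw [hπ.bind_stepDist]
      exact hgL z
    · rw [hπ.bind_stepDist]
      exact hL
  · have hi := hr.integrable_cycleSum_natCast_add_one (hG z)
    refine ⟨hi.1, ?_⟩
    rw [(hπ.mean_stationary_greenReal hr (hG z)).2, hi.2, lintegral_returnTime]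
  · have hn := fun n => hπ.inL1_stepDist hP (hgL z) n x
    refine ⟨fun n => integrable_evalFrom (hn n), ?_⟩
    simp only [fun n => integral_evalFrom (hn n)]
    exact hap.tendsto_mean hP hπ (hgL z) x
  · have hn := fun n => hπ.inL1_stepDist hP hL n x
    refine ⟨fun n => integrable_evalFrom (hn n), ?_⟩
    simp only [fun n => integral_evalFrom (hn n)]
    -- Any target state provides a suitable solution of Poisson's equation; x itself is taken.
    exact hap.summable_mean hP hπ (hgL x) (heq x) x
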